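/- **Setting.** Let $d\ge 1$, $p\ge 0$, let $\Omega\subset\mathbb R^d$ be a bounded domain and let $(\hat K_\kappa)_\kappa$ be a finite family of Lagrange reference elements (compact convex bodies with nodes and polynomial shape functions that are dual to the nodes and sum to $1$). A mesh covers $\overline\Omega$ by finitely many elements $T=F_T(\hat K_{\kappa(T)})$ with disjoint interiors, where $F_T$ and its inverse $G_T$ are smooth; it has nodes $x_i$ (the images of the reference nodes) and it is conforming, that is, the transported reference shape functions agree on common points of elements and so define $C^0$ shape functions $N_i$ on $\overline\Omega$. Let $h$ be the largest element diameter. To every node belong a nodal patch $\omega_i$ (a union of elements, including all elements that contain $x_i$), the index set $\mathcal S_i=\{k: x_k\in\omega_i\}$, a radius $\rho_i>0$ and weights $w_{i,k}$. Given nodal data $(u_k)$, the local approximant is $U_i(x)=q_i\big((x-x_i)/\rho_i\big)$, where $q_i\in\mathcal P_p$ (polynomials of total degree at most $p$) minimizes $\tfrac12\sum_{k\in\mathcal S_i}w_{i,k}^2\big(q((x_k-x_i)/\rho_i)-u_k\big)^2$ over $q\in\mathcal P_p$ subject to $q(0)=u_i$ (constrained weighted least squares). Put $$u^h=\sum_iN_iU_i,\qquad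 \widetilde D^\alpha u^h:=\sum_i N_i\,D^\alpha U_i,\qquad R^\alpha:=\sum_i\sum_{0<\beta\le\alpha}\binom\alpha\beta D^\beta N_i\,D^{\alpha-\beta}U_i ,$$ where $R^\alpha$ is taken elementwise. The jump $[\![f]\!]$ at a common point of two distinct elements is the difference of the limits of $f$ from the interiors of the two elements. **Claims.** (0) For arbitrary nodal data and every multi-index $\alpha$, in the interior of every element $D^\alpha u^h=\widetilde D^\alpha u^h+R^\alpha$, and $\sum_i D^\alpha N_i=0$ if $\alpha\neq0$; moreover $\widetilde D^\alpha u^h$ is continuous on $\overline\Omega$. (1) (Polynomial exactness.) Suppose that the local problems are well posed: for every $i$, no nonzero $q\in\mathcal P_p$ satisfies $q(0)=0$ and $w_{i,k}\,q((x_k-x_i)/\rho_i)=0$ for all $k\in\mathcal S_i$. If $u$ coincides on $\overline\Omega$ with a polynomial in $\mathcal P_p$ and $u_k=u(x_k)$, then for $|\alpha|\le p$: $\widetilde D^\alpha u^h=D^\alpha u^h$ in $\Omega$, $R^\alpha=0$ in the interior of every element, and all jumps $[\![D^\alpha u^h]\!]$ between elements exist and vanish. (2) (Approximation order.) Let $\sigma,\lambda,W\in\mathbb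 R$, $\lambda>0$, $m,L\in\mathbb N$ and $u\in C^{p+1}(\overline\Omega)$. There is a constant $C$, depending only on $d$, $p$, $\Omega$, the reference elements, $\sigma,\lambda,W,m,L$ and $u$ (in particular not on the mesh or on $h$), such that for every discretization with - $\|DF_T\|\le\sigma h$ on the reference element and $\|D^kG_T\|\le\sigma h^{-k}$ on $T$ for $1\le k\le p+1$, - every patch $\omega_i$ contained in the union of the $L+1$ topological layers of elements around $x_i$ (the first layer consists of the elements containing $x_i$, each further one adds the elements touching the previous ones), $|\mathcal S_i|\le m$, and $h\le\sigma\rho_i$, - $|w_{i,k}|\le W$ for $k\in\mathcal S_i$, and smallest eigenvalue of each moment matrix (the matrix of $q\mapsto\sum_{k\in\mathcal S_i}w_{i,k}^2\,q((x_k-x_i)/\rho_i)^2$ on $\mathcal P_p$ in the monomial basis) at least $\lambda$, and for $u_k=u(x_k)$ and all $|\alpha|\le p+1$: $$\|D^\alpha u-\widetilde D^\alpha u^h\|_{L^\infty(\Omega)}\le C\,h^{p+1-|\alpha|},\qquad |R^\alpha|\le C\,h^{p+1-|\alpha|}\ \text{ in the interior of every element},$$ and the jumps of $D^\alpha u^h$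 at all common points of two distinct elements exist and satisfy $\big|[\![D^\alpha u^h]\!]\big|\le C\,h^{p+1-|\alpha|}$. -/

import Mathlib

open Set Filter Topology
open scoped ContDiff

namespace MiGFEM

/-- Euclidean `d`-space. -/
abbrev E (d : ℕ) := EuclideanSpace ℝ (Fin d)

/-! ### Polynomials and multi-index derivatives -/

/-- The value of the polynomial `q` in `d` variables at the point `x`. -/
noncomputable def peval {d : ℕ} (q : MvPolynomial (Fin d) ℝ) (x : E d) : ℝ :=
  MvPolynomial.eval (fun j => x j) q

/-- The space `𝒫_p` of polynomials of total degree at most `p`. -/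
noncomputable abbrev Poly (d p : ℕ) : Submodule ℝ (MvPolynomial (Fin d) ℝ) :=
  MvPolynomial.restrictTotalDegree (Fin d) ℝ p

/-- The partial derivative `∂f/∂x_j`. -/
noncomputable def partialD {d : ℕ} (j : Fin d) (f : E d → ℝ) : E d → ℝ :=
  fun x => fderiv ℝ f x (EuclideanSpace.single j 1)

/-- The classical derivative `D^α f = ∂_1^{α_1} ⋯ ∂_d^{α_d} f` for a multi-index `α`. -/
noncomputable def mderiv {d : ℕ} (α : Fin d → ℕ) (f : E d → ℝ) : E d → ℝ :=
  (List.finRange d).foldr (fun j g => (partialD j)^[α j] g) f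

/-- The order `|α|` of a multi-index. -/
def order {d : ℕ} (α : Fin d → ℕ) : ℕ := ∑ j, α j

/-- The multi-index binomial coefficient. -/
def mchoose {d : ℕ} (α β : Fin d → ℕ) : ℕ := ∏ j, (α j).choose (β j)

/-! ### Conforming finite element meshes and their `C⁰` shape functions -/

/-- A Lagrange reference element: a convex body with nodes and polynomial shape functions that are
dual to the nodes and sum to one. -/
structure RefElement (d : ℕ) where
  carrier : Set (E d)
  isCompact : IsCompact carrier
  convex : Convex ℝ carrier
  interior_nonempty : (interior carrier).Nonempty
  card : ℕ
  pt : Fin card → E d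
  pt_mem : ∀ a, pt a ∈ carrier
  shape : Fin card → MvPolynomial (Fin d) ℝ
  shape_pt : ∀ a b, peval (shape a) (pt b) = if a = b then 1 else 0
  sum_shape : ∀ x ∈ carrier, ∑ a, peval (shape a) x = 1

/-- A conforming finite element mesh of (the closure of) `Ω`, whose elements are images of reference
elements taken from the family `R` under smooth maps with smooth inverses (affine elements,
isoparametric elements, ...). -/
structure Mesh {d : ℕ} (Ω : Set (E d)) {κ : Type*} (R : κ → RefElement d) where
  nCells : ℕ
  nNodes : ℕ
  /-- the reference element of each element -/
  kind : Fin nCells → κ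
  /-- the element map from the reference element onto the element -/
  map : Fin nCells → E d → E d
  /-- the inverse of the element map -/
  coord : Fin nCells → E d → E d
  map_smooth : ∀ T, ∀ a ∈ (R (kind T)).carrier, ContDiffAt ℝ ∞ (map T) a
  coord_smooth : ∀ T, ∀ a ∈ (R (kind T)).carrier, ContDiffAt ℝ ∞ (coord T) (map T a)
  coord_map : ∀ T, ∀ a ∈ (R (kind T)).carrier, coord T (map T a) = a
  cover : ⋃ T, map T '' (R (kind T)).carrier = closure Ω
  disjoint_interior : ∀ T T', T ≠ T' →
    Disjoint (interior (map T '' (R (kind T)).carrier))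
      (interior (map T' '' (R (kind T')).carrier))
  node : Fin nNodes → E d
  node_injective : Function.Injective node
  /-- connectivity: the global number of a local node -/
  conn : (T : Fin nCells) → Fin (R (kind T)).card → Fin nNodes
  node_conn : ∀ T a, node (conn T a) = map T ((R (kind T)).pt a)
  conn_surjective : ∀ i, ∃ T a, conn T a = i
  /-- conformity: on common points of two elements the element shape functions belonging to the
  same global node agree (a shape function counts as zero on an element without that node) -/
  conforming : ∀ T T' i x, x ∈ map T '' (R (kind T)).carrier →
    x ∈ map T' '' (R (kind T')).carrier →
    (∑ a, if conn T a = i then peval ((R (kind T)).shape a) (coord T x) else 0) =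
      ∑ a, if conn T' a = i then peval ((R (kind T')).shape a) (coord T' x) else 0

namespace Mesh

variable {d : ℕ} {Ω : Set (E d)} {κ : Type*} {R : κ → RefElement d}

/-- The (closed) element with number `T`. -/
def cell (M : Mesh Ω R) (T : Fin M.nCells) : Set (E d) := M.map T '' (R (M.kind T)).carrier

/-- The mesh size `h`, the largest element diameter. -/
noncomputable def h (M : Mesh Ω R) : ℝ := ⨆ T, Metric.diam (M.cell T)

/-- The shape function of node `i` on the element `T`: the transported reference shape function. -/
noncomputable def localShape (M : Mesh Ω R) (T : Fin M.nCells) (i : Fin M.nNodes) (x : E d) : ℝ :=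
  ∑ a, if M.conn T a = i then peval ((R (M.kind T)).shape a) (M.coord T x) else 0

open Classical in
/-- The global finite element shape function `N_i`. -/
noncomputable def N (M : Mesh Ω R) (i : Fin M.nNodes) (x : E d) : ℝ :=
  if hx : ∃ T, x ∈ M.cell T then M.localShape hx.choose i x else 0

theorem N_eq_localShape (M : Mesh Ω R) (i : Fin M.nNodes) {T : Fin M.nCells} {x : E d}
    (hx : x ∈ M.cell T) : M.N i x = M.localShape T i x := by
  have hex : ∃ T, x ∈ M.cell T := ⟨T, hx⟩
  unfold N
  rw [dif_pos hex]
  exact M.conforming _ _ i x hex.choose_spec hx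

open Classical in
/-- `layer i s` consists of the elements within `s + 1` topological layers around node `i`: the first
layer is formed by the elements that contain the node, each further one by the elements that touch
an element of the previous layers. -/
noncomputable def layer (M : Mesh Ω R) (i : Fin M.nNodes) : ℕ → Finset (Fin M.nCells)
  | 0 => Finset.univ.filter fun T => M.node i ∈ M.cell T
  | s + 1 => Finset.univ.filter fun T => ∃ T' ∈ M.layer i s, (M.cell T ∩ M.cell T').Nonempty

end Mesh

/-! ### Constrained weighted least squares -/

/-- `½ ∑_k (w_k (q(ξ_k) - v_k))²`, the weighted least-squares functional. -/
noncomputable def lsq {d : ℕ} {ι : Type*} (S : Finset ι) (w v : ι → ℝ) (ξ : ι → E d)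
    (q : MvPolynomial (Fin d) ℝ) : ℝ :=
  1 / 2 * ∑ k ∈ S, (w k * (peval q (ξ k) - v k)) ^ 2

/-- `q ∈ 𝒫_p` solves: minimise the weighted least-squares functional over `𝒫_p` subject to
`q(0) = b`. -/
def IsCWLS {d : ℕ} (p : ℕ) {ι : Type*} (S : Finset ι) (w v : ι → ℝ) (ξ : ι → E d) (b : ℝ)
    (q : MvPolynomial (Fin d) ℝ) : Prop :=
  q ∈ Poly d p ∧ peval q 0 = b ∧
    ∀ q' ∈ Poly d p, peval q' 0 = b → lsq S w v ξ q ≤ lsq S w v ξ q'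

theorem exists_isCWLS {d : ℕ} (p : ℕ) {ι : Type*} (S : Finset ι) (w v : ι → ℝ) (ξ : ι → E d)
    (b : ℝ) : ∃ q, IsCWLS p S w v ξ b q := by
  let ev : E d → MvPolynomial (Fin d) ℝ →ₗ[ℝ] ℝ := fun x =>
    (MvPolynomial.aeval (R := ℝ) (fun j => x j)).toLinearMap
  have hev : ∀ x q, ev x q = peval q x := fun x q => by
    simp [ev, peval, MvPolynomial.aeval_eq_eval]
  let Φ : MvPolynomial (Fin d) ℝ →ₗ[ℝ] EuclideanSpace ℝ S :=
    (WithLp.linearEquiv 2 ℝ (S → ℝ)).symm.toLinearMap ∘ₗ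
      LinearMap.pi fun k => w k • ev (ξ k)
  have hΦ : ∀ q (k : S), Φ q k = w k * peval q (ξ k) := fun q k => by
    simp [Φ, hev]
  let K : Submodule ℝ (EuclideanSpace ℝ S) := (Poly d p ⊓ LinearMap.ker (ev 0)).map Φ
  let y : EuclideanSpace ℝ S := WithLp.toLp 2 fun k => w k * (v k - b)
  obtain ⟨z, hz, hmin⟩ := K.exists_norm_eq_iInf_of_complete_subspace
    (Submodule.complete_of_finiteDimensional K) y
  obtain ⟨q₀, ⟨hq₀P, hq₀⟩, rfl⟩ := hz
  have hC : MvPolynomial.C b ∈ Poly d p := by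
    rw [MvPolynomial.mem_restrictTotalDegree]; simp
  have hCe : ∀ x : E d, peval (MvPolynomial.C b) x = b := fun x => by simp [peval]
  have hadd : ∀ (q q' : MvPolynomial (Fin d) ℝ) (x : E d),
      peval (q + q') x = peval q x + peval q' x := fun q q' x => by simp [peval]
  have hsub : ∀ (q q' : MvPolynomial (Fin d) ℝ) (x : E d),
      peval (q - q') x = peval q x - peval q' x := fun q q' x => by simp [peval]
  have hobj : ∀ q, lsq S w v ξ (q + MvPolynomial.C b) = 1 / 2 * ‖y - Φ q‖ ^ 2 := fun q => by
    rw [EuclideanSpace.norm_sq_eq, lsq, ← Finset.sum_coe_sort]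
    congr 1
    refine Finset.sum_congr rfl fun k _ => ?_
    rw [PiLp.sub_apply, hΦ, hadd, hCe, Real.norm_eq_abs, sq_abs]
    simp only [y]
    ring
  have hq₀' : peval q₀ 0 = 0 := by rw [← hev]; exact hq₀
  refine ⟨q₀ + MvPolynomial.C b, Submodule.add_mem _ hq₀P hC, by rw [hadd, hCe, hq₀', zero_add],
    fun q' hq' hb => ?_⟩
  have hq'e : q' = (q' - MvPolynomial.C b) + MvPolynomial.C b := by ring
  rw [hq'e, hobj, hobj]
  have hle : ‖y - Φ q₀‖ ≤ ‖y - Φ (q' - MvPolynomial.C b)‖ := by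
    rw [hmin]
    refine ciInf_le ⟨0, ?_⟩ (⟨Φ (q' - MvPolynomial.C b), Submodule.mem_map_of_mem
      ⟨Submodule.sub_mem _ hq' hC, ?_⟩⟩ : K)
    · rintro _ ⟨_, rfl⟩
      exact norm_nonneg _
    · change ev 0 _ = 0
      rw [hev, hsub, hCe, hb, sub_self]
  gcongr

/-! ### The mesh-intrinsic generalized finite element method -/

/-- The discretization data: a mesh, and for every node `i` a nodal patch (a set of elements that
contains all elements at the node), a patch radius `ρ_i` and weights `w_{i,k}`. -/
structure Disc {d : ℕ} (Ω : Set (E d)) {κ : Type*} (R : κ → RefElement d) extends Mesh Ω R where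
  patch : Fin nNodes → Finset (Fin nCells)
  star_subset_patch : ∀ i, toMesh.layer i 0 ⊆ patch i
  ρ : Fin nNodes → ℝ
  ρ_pos : ∀ i, 0 < ρ i
  w : Fin nNodes → Fin nNodes → ℝ

namespace Disc

variable {d : ℕ} {Ω : Set (E d)} {κ : Type*} {R : κ → RefElement d}

/-- The nodal patch `ω_i` as a region. -/
def patchRegion (D : Disc Ω R) (i : Fin D.nNodes) : Set (E d) := ⋃ T ∈ D.patch i, D.cell T

open Classical in
/-- The patch node set `S_i = {k : x_k ∈ ω_i}`. -/
noncomputable def S (D : Disc Ω R) (i : Fin D.nNodes) : Finset (Fin D.nNodes) :=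
  Finset.univ.filter fun k => D.node k ∈ D.patchRegion i

/-- The scaled local coordinate `ξ = (x - x_i) / ρ_i`. -/
noncomputable def ξ (D : Disc Ω R) (i : Fin D.nNodes) (x : E d) : E d :=
  (D.ρ i)⁻¹ • (x - D.node i)

/-- The polynomial (in the scaled local coordinate) reconstructed on the patch of node `i` from the
nodal data `v`: a solution of the constrained weighted least-squares problem on `S_i` with
interpolation at `x_i`. -/
noncomputable def recon (D : Disc Ω R) (p : ℕ) (v : Fin D.nNodes → ℝ) (i : Fin D.nNodes) :
    MvPolynomial (Fin d) ℝ :=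
  (exists_isCWLS p (D.S i) (D.w i) v (fun k => D.ξ i (D.node k)) (v i)).choose

/-- The local approximant `U_i`. -/
noncomputable def U (D : Disc Ω R) (p : ℕ) (v : Fin D.nNodes → ℝ) (i : Fin D.nNodes) (x : E d) :
    ℝ :=
  peval (D.recon p v i) (D.ξ i x)

/-- The global approximation `u^h = ∑ N_i U_i`. -/
noncomputable def uh (D : Disc Ω R) (p : ℕ) (v : Fin D.nNodes → ℝ) (x : E d) : ℝ :=
  ∑ i, D.N i x * D.U p v i x

/-- The intrinsic derivative `D̃^α u^h = ∑ N_i D^α U_i`. -/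
noncomputable def intrinsic (D : Disc Ω R) (p : ℕ) (v : Fin D.nNodes → ℝ) (α : Fin d → ℕ)
    (x : E d) : ℝ :=
  ∑ i, D.N i x * mderiv α (D.U p v i) x

/-- The remainder `R^α = ∑_i ∑_{0 < β ≤ α} (α choose β) D^β N_i D^{α-β} U_i`; it is meaningful in
the interiors of the elements. -/
noncomputable def remainder (D : Disc Ω R) (p : ℕ) (v : Fin D.nNodes → ℝ) (α : Fin d → ℕ)
    (x : E d) : ℝ :=
  ∑ i, ∑ β ∈ Finset.Ioc 0 α,
    (mchoose α β : ℝ) * mderiv β (D.N i) x * mderiv (α - β) (D.U p v i) x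

/-- The nodal values of a function. -/
def nodal (D : Disc Ω R) (u : E d → ℝ) : Fin D.nNodes → ℝ := fun i => u (D.node i)

/-- The local reconstruction problems of degree `p` are well posed (their saddle point matrices are
nonsingular): no nonzero polynomial of degree at most `p` that vanishes at `x_i` is invisible to the
weighted sampling on `S_i`. -/
def WellPosed (D : Disc Ω R) (p : ℕ) : Prop :=
  ∀ i, ∀ q ∈ Poly d p, peval q 0 = 0 →
    (∀ k ∈ D.S i, D.w i k * peval q (D.ξ i (D.node k)) = 0) → q = 0

/-- Uniform regularity of a discretization, with constants independent of the mesh size. -/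
structure Regular (D : Disc Ω R) (p : ℕ) (σ lam W : ℝ) (m L : ℕ) : Prop where
  /-- regularity of the mesh: the element maps scale like `h`, their inverses like `h⁻¹` -/
  map_le : ∀ T, ∀ a ∈ (R (D.kind T)).carrier, ‖fderiv ℝ (D.map T) a‖ ≤ σ * D.h
  coord_le : ∀ T, ∀ a ∈ (R (D.kind T)).carrier, ∀ k, 1 ≤ k → k ≤ p + 1 →
    ‖iteratedFDeriv ℝ k (D.coord T) (D.map T a)‖ ≤ σ / D.h ^ k
  /-- the patches have a bounded number of layers and of nodes, and radii not smaller than a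
  multiple of `h` -/
  patch_subset : ∀ i, D.patch i ⊆ D.layer i L
  card_le : ∀ i, (D.S i).card ≤ m
  h_le : ∀ i, D.h ≤ σ * D.ρ i
  /-- the weights are bounded and the smallest eigenvalues of the moment matrices
  `P_iᵀ W_i² P_i` (in the monomial basis in `ξ`) are at least `lam` -/
  weight_le : ∀ i, ∀ k ∈ D.S i, |D.w i k| ≤ W
  moment_ge : ∀ i, ∀ q ∈ Poly d p,
    lam * ∑ e ∈ q.support, q.coeff e ^ 2 ≤
      ∑ k ∈ D.S i, (D.w i k * peval q (D.ξ i (D.node k))) ^ 2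

/-- `f` has the jump `J` at the point `x` of the interface between the elements `T` and `T'`: the
difference of its limits at `x` from the interiors of `T` and of `T'`. -/
def HasJump (D : Disc Ω R) (T T' : Fin D.nCells) (f : E d → ℝ) (x : E d) (J : ℝ) : Prop :=
  ∃ a b, Tendsto f (𝓝[interior (D.cell T)] x) (𝓝 a) ∧
    Tendsto f (𝓝[interior (D.cell T')] x) (𝓝 b) ∧ J = a - b

end Disc

end MiGFEM

/-!
On a fixed element the global shape functions are smooth functions that sum to one, also on a
neighbourhood of the closed element, since the reference shape functions sum to one as polynomials.
Leibniz' rule therefore splits `D^α u^h` into the intrinsic derivative and a remainder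
(`Mesh.mderiv_sum_localShape_mul`), both of which make sense up to the boundary of the element.
The intrinsic parts of two neighbouring elements agree by conformity, so a jump of `D^α u^h` is a
difference of two one-sided remainders (`Disc.hasJump_mderiv_uh`). As the derivatives `D^β N_i`,
`β ≠ 0`, sum to zero, the remainder only sees the differences `D^γ U_i - D^γ u`
(`Mesh.elemRemainder_eq`).

If `u` is a polynomial of degree at most `p`, well-posedness forces `U_i = u`, and all these
differences vanish. In general everything reduces to
`|D^γ U_i - D^γ u| ≤ C h ^ (p + 1 - |γ|)` on the elements at node `i` (`exists_bound_mderiv_U`),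
because `|D^β N_i| ≤ C h ^ (-|β|)` (`exists_bound_elemShape`).

For this estimate `U_i` is compared with the Taylor polynomial of `u` at `x_i`. The domain need not
be convex, so Taylor's estimate is proved along chains of elements: on one element the mean value
inequality on the convex reference element bounds oscillations by `h` times the next derivatives,
and at most `L + 1` elements link `x_i` to any point of its patch (`Mesh.abs_mderivW_le_on_layer`).
Derivatives of `u` at boundary points are taken within `closure Ω`, where they are unique and
symmetric because every point lies in a diffeomorphic image of a convex body
(`Mesh.fat_closure`). The Taylor polynomial is an admissible competitor whose residual is
`O(h ^ (p + 1))`; minimality and the lower bound on the moment matrix turn this into a bound for the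
coefficients of the difference of the two polynomials (`IsCWLS.abs_coeff_sub_le`).
-/

namespace MiGFEM

/-! ### Iterated partial derivatives within a set -/

/-- The partial derivative `∂f/∂x_j` relative to the set `s`. -/
noncomputable def partialDW {d : ℕ} (s : Set (E d)) (j : Fin d) (f : E d → ℝ) : E d → ℝ :=
  fun x => fderivWithin ℝ f s x (EuclideanSpace.single j 1)

/-- The iterated partial derivative relative to `s` along a list of coordinate directions; the head
of the list is the outermost derivative. -/
noncomputable def listD {d : ℕ} (s : Set (E d)) (l : List (Fin d)) (f : E d → ℝ) : E d → ℝ :=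
  l.foldr (partialDW s) f

/-- The list of directions of a multi-index: `j` is repeated `α j` times. -/
def mlist {d : ℕ} (α : Fin d → ℕ) : List (Fin d) :=
  (List.finRange d).flatMap fun j => List.replicate (α j) j

/-- The derivative `D^α f` relative to the set `s`. -/
noncomputable def mderivW {d : ℕ} (s : Set (E d)) (α : Fin d → ℕ) (f : E d → ℝ) : E d → ℝ :=
  listD s (mlist α) f

/-- Sets on which iterated derivatives are unique and symmetric: every point has a spanning tangent
cone and is a limit of interior points. -/
structure Fat {d : ℕ} (s : Set (E d)) : Prop where
  uniqueDiffOn : UniqueDiffOn ℝ s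
  subset_closure : s ⊆ closure (interior s)

section Calculus

variable {d : ℕ} {s : Set (E d)}

theorem _root_.IsOpen.fat (hs : IsOpen s) : Fat s :=
  ⟨hs.uniqueDiffOn, by rw [hs.interior_eq]; exact subset_closure⟩

@[simp] theorem listD_nil (f : E d → ℝ) : listD s [] f = f := rfl

theorem listD_cons (j : Fin d) (l : List (Fin d)) (f : E d → ℝ) :
    listD s (j :: l) f = partialDW s j (listD s l f) := rfl

theorem listD_append (l l' : List (Fin d)) (f : E d → ℝ) :
    listD s (l ++ l') f = listD s l (listD s l' f) := by
  simp [listD]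

theorem partialDW_univ (j : Fin d) (f : E d → ℝ) : partialDW univ j f = partialD j f := by
  ext x; simp [partialDW, partialD]

theorem listD_replicate_univ (n : ℕ) (j : Fin d) (f : E d → ℝ) :
    listD univ (List.replicate n j) f = (partialD j)^[n] f := by
  induction n with
  | zero => rfl
  | succ n ih =>
    rw [List.replicate_succ, listD_cons, ih, partialDW_univ, Function.iterate_succ_apply']

theorem mderiv_eq_mderivW_univ (α : Fin d → ℕ) (f : E d → ℝ) :
    mderiv α f = mderivW univ α f := by
  unfold mderiv mderivW mlist
  induction List.finRange d with
  | nil => rfl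
  | cons j l ih => rw [List.foldr_cons, List.flatMap_cons, listD_append, ih, listD_replicate_univ]

theorem count_mlist (α : Fin d → ℕ) (j : Fin d) : (mlist α).count j = α j := by
  unfold mlist
  rw [List.count_flatMap]
  have : ∀ l : List (Fin d), l.Nodup →
      (l.map (List.count j ∘ fun i => List.replicate (α i) i)).sum = if j ∈ l then α j else 0 := by
    intro l hl
    induction l with
    | nil => simp
    | cons i l ih =>
      rw [List.nodup_cons] at hl
      rw [List.map_cons, List.sum_cons, ih hl.2]
      by_cases h : i = j
      · subst h; simp [hl.1]
      · simp [List.count_replicate, h, Ne.symm h]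
  rw [this _ (List.nodup_finRange d)]
  simp

theorem length_mlist (α : Fin d → ℕ) : (mlist α).length = order α := by
  unfold mlist order
  rw [List.length_flatMap]
  simp [List.sum_ofFn, ← List.ofFn_eq_map]

theorem order_add (α β : Fin d → ℕ) : order (α + β) = order α + order β := by
  simp [order, Finset.sum_add_distrib]

theorem order_single (j : Fin d) : order (Pi.single j 1 : Fin d → ℕ) = 1 := by
  simp [order]

theorem order_mono {α β : Fin d → ℕ} (h : β ≤ α) : order β ≤ order α :=
  Finset.sum_le_sum fun j _ => h j

theorem mlist_add_single_perm (α : Fin d → ℕ) (j : Fin d) :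
    (mlist (α + Pi.single j 1)).Perm (j :: mlist α) := by
  rw [List.perm_iff_count]
  intro i
  rw [count_mlist, List.count_cons, count_mlist]
  by_cases h : i = j
  · subst h; simp
  · simp [h, Ne.symm h]

theorem mlist_zero : mlist (0 : Fin d → ℕ) = [] := by
  simp [mlist]

@[simp] theorem mderivW_zero (f : E d → ℝ) : mderivW s 0 f = f := by
  rw [mderivW, mlist_zero, listD_nil]

theorem partialDW_contDiffOn (hs : Fat s) {f : E d → ℝ} {n m : ℕ} (hf : ContDiffOn ℝ n f s)
    (hmn : m + 1 ≤ n) (j : Fin d) : ContDiffOn ℝ m (partialDW s j f) s :=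
  (hf.fderivWithin hs.uniqueDiffOn (by exact_mod_cast hmn)).clm_apply contDiffOn_const

theorem listD_contDiffOn (hs : Fat s) {f : E d → ℝ} {n : ℕ} (hf : ContDiffOn ℝ n f s)
    (l : List (Fin d)) {m : ℕ} (hmn : m + l.length ≤ n) : ContDiffOn ℝ m (listD s l f) s := by
  induction l generalizing m with
  | nil => exact hf.of_le (by exact_mod_cast hmn)
  | cons j l ih =>
    rw [listD_cons]
    exact partialDW_contDiffOn hs (ih (m := m + 1) (by simp at hmn; omega)) le_rfl j

theorem mderivW_contDiffOn (hs : Fat s) {f : E d → ℝ} {n : ℕ} (hf : ContDiffOn ℝ n f s)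
    (α : Fin d → ℕ) {m : ℕ} (hmn : m + order α ≤ n) : ContDiffOn ℝ m (mderivW s α f) s :=
  listD_contDiffOn hs hf _ (by rwa [length_mlist])

theorem partialDW_congr {f g : E d → ℝ} (h : EqOn f g s) (j : Fin d) :
    EqOn (partialDW s j f) (partialDW s j g) s := fun x hx => by
  simp only [partialDW]
  rw [fderivWithin_congr h (h hx)]

theorem listD_congr {f g : E d → ℝ} (h : EqOn f g s) (l : List (Fin d)) :
    EqOn (listD s l f) (listD s l g) s := by
  induction l with
  | nil => exact h
  | cons j l ih => exact partialDW_congr ih j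

theorem mderivW_congr {f g : E d → ℝ} (h : EqOn f g s) (α : Fin d → ℕ) :
    EqOn (mderivW s α f) (mderivW s α g) s := listD_congr h _

/-- Derivatives relative to a set agree with those relative to a smaller open set. -/
theorem mderivW_of_isOpen_subset {o : Set (E d)} (ho : IsOpen o) (hos : o ⊆ s) (f : E d → ℝ)
    (α : Fin d → ℕ) : EqOn (mderivW s α f) (mderivW o α f) o := by
  unfold mderivW
  induction mlist α with
  | nil => exact fun _ _ => rfl
  | cons j l ih =>
    intro x hx
    rw [listD_cons, listD_cons, ← partialDW_congr ih j hx]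
    simp only [partialDW]
    rw [fderivWithin_of_isOpen ho hx,
      fderivWithin_of_mem_nhds (mem_of_superset (ho.mem_nhds hx) hos)]

theorem mderiv_eqOn_mderivW {o : Set (E d)} (ho : IsOpen o) (f : E d → ℝ) (α : Fin d → ℕ) :
    EqOn (mderiv α f) (mderivW o α f) o := by
  rw [mderiv_eq_mderivW_univ]
  exact mderivW_of_isOpen_subset ho (subset_univ _) f α

theorem mderiv_congr_of_isOpen {o : Set (E d)} (ho : IsOpen o) {f g : E d → ℝ} (h : EqOn f g o)
    (α : Fin d → ℕ) : EqOn (mderiv α f) (mderiv α g) o := fun x hx => by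
  rw [mderiv_eqOn_mderivW ho f α hx, mderiv_eqOn_mderivW ho g α hx, mderivW_congr h α hx]

/-- Partial derivatives of a `C²` function commute. -/
theorem partialDW_comm (hs : Fat s) {f : E d → ℝ} (hf : ContDiffOn ℝ 2 f s) (i j : Fin d) :
    EqOn (partialDW s i (partialDW s j f)) (partialDW s j (partialDW s i f)) s := by
  intro x hx
  have hd : DifferentiableWithinAt ℝ (fderivWithin ℝ f s) s x :=
    ((hf.fderivWithin hs.uniqueDiffOn (m := 1) (by norm_num)).differentiableOn (by norm_num)) x hx
  have key : ∀ a b : E d, fderivWithin ℝ (fun y => fderivWithin ℝ f s y a) s x b =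
      fderivWithin ℝ (fderivWithin ℝ f s) s x b a := by
    intro a b
    have h := fderivWithin_clm_apply (hs.uniqueDiffOn x hx) hd
      (differentiableWithinAt_const (c := a))
    rw [h]
    simp
  have hsym := (hf x hx).isSymmSndFDerivWithinAt (by simp) hs.uniqueDiffOn
    (hs.subset_closure hx) hx
  simp only [partialDW]
  change fderivWithin ℝ (fun y => fderivWithin ℝ f s y _) s x _ =
    fderivWithin ℝ (fun y => fderivWithin ℝ f s y _) s x _
  rw [key, key, hsym]

theorem listD_perm (hs : Fat s) {f : E d → ℝ} {n : ℕ} (hf : ContDiffOn ℝ n f s)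
    {l l' : List (Fin d)} (h : l.Perm l') (hn : l.length ≤ n) :
    EqOn (listD s l f) (listD s l' f) s := by
  induction h with
  | nil => exact fun _ _ => rfl
  | cons j _ ih =>
    exact partialDW_congr (ih (by simp at hn; omega)) j
  | swap i j l =>
    refine partialDW_comm hs (listD_contDiffOn hs hf l (m := 2) ?_) _ _
    simp at hn; omega
  | trans h₁ _ ih₁ ih₂ => exact (ih₁ hn).trans (ih₂ (h₁.length_eq ▸ hn))

theorem partialDW_mderivW (hs : Fat s) {f : E d → ℝ} {n : ℕ} (hf : ContDiffOn ℝ n f s)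
    {α : Fin d → ℕ} (hα : order α + 1 ≤ n) (j : Fin d) :
    EqOn (partialDW s j (mderivW s α f)) (mderivW s (α + Pi.single j 1) f) s :=
  (listD_perm hs hf (mlist_add_single_perm α j)
    (by rw [length_mlist, order_add, order_single]; exact hα)).symm

/-- The coordinate partial derivatives bound the operator norm of the derivative. -/
theorem norm_fderivWithin_le_of_partialDW {f : E d → ℝ} {x : E d} {C : ℝ}
    (h : ∀ j, |partialDW s j f x| ≤ C) : ‖fderivWithin ℝ f s x‖ ≤ d * C := by
  rcases Nat.eq_zero_or_pos d with rfl | hd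
  · have : fderivWithin ℝ f s x = 0 := by
      ext v; rw [Subsingleton.elim v 0]; simp
    simp [this]
  have hC : 0 ≤ C := (abs_nonneg _).trans (h ⟨0, hd⟩)
  refine ContinuousLinearMap.opNorm_le_bound _ (by positivity) fun v => ?_
  have hv : v = ∑ j, v j • (EuclideanSpace.single j (1 : ℝ) : E d) := by
    ext i; simp [Finset.sum_apply, Pi.single_apply]
  conv_lhs => rw [hv, map_sum]
  calc ‖∑ j, fderivWithin ℝ f s x (v j • (EuclideanSpace.single j (1 : ℝ) : E d))‖
      ≤ ∑ j : Fin d, ‖v‖ * C := by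
        refine norm_sum_le_of_le _ fun j _ => ?_
        rw [map_smul, norm_smul]
        exact mul_le_mul (PiLp.norm_apply_le v j) (h j) (norm_nonneg _) (norm_nonneg _)
    _ = d * C * ‖v‖ := by simp; ring

theorem listD_eq_iteratedFDerivWithin (hs : Fat s) {f : E d → ℝ} {n : ℕ}
    (hf : ContDiffOn ℝ n f s) (l : List (Fin d)) (hn : l.length ≤ n) :
    ∀ x ∈ s, listD s l f x =
      iteratedFDerivWithin ℝ l.length f s x fun k => EuclideanSpace.single (l.get k) 1 := by
  induction l with
  | nil => intro x _; simp
  | cons j l ih =>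
    intro x hx
    have hn' : l.length + 1 ≤ n := by simpa using hn
    rw [listD_cons, partialDW_congr (ih (by omega)) j hx]
    have hd : DifferentiableWithinAt ℝ (iteratedFDerivWithin ℝ l.length f s) s x :=
      hf.differentiableOn_iteratedFDerivWithin (by exact_mod_cast hn') hs.uniqueDiffOn x hx
    simp only [partialDW]
    have hap := (ContinuousMultilinearMap.apply ℝ (fun _ : Fin l.length => E d) ℝ
      (fun k => EuclideanSpace.single (l.get k) 1)).hasFDerivAt.comp_hasFDerivWithinAt x
        hd.hasFDerivWithinAt
    have := hap.fderivWithin (hs.uniqueDiffOn x hx)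
    erw [this]
    simp only [List.length_cons]
    rw [iteratedFDerivWithin_succ_apply_left]
    rfl

theorem abs_mderivW_le (hs : Fat s) {f : E d → ℝ} {n : ℕ} (hf : ContDiffOn ℝ n f s)
    (α : Fin d → ℕ) (hn : order α ≤ n) {x : E d} (hx : x ∈ s) :
    |mderivW s α f x| ≤ ‖iteratedFDerivWithin ℝ (order α) f s x‖ := by
  rw [← length_mlist α] at hn ⊢
  rw [mderivW, listD_eq_iteratedFDerivWithin hs hf _ hn x hx, ← Real.norm_eq_abs]
  refine (ContinuousMultilinearMap.le_opNorm _ _).trans ?_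
  simp

theorem mderivW_sum (hs : Fat s) {ι : Type*} (t : Finset ι) {f : ι → E d → ℝ} {n : ℕ}
    (hf : ∀ i ∈ t, ContDiffOn ℝ n (f i) s) {α : Fin d → ℕ} (hn : order α ≤ n) :
    EqOn (mderivW s α fun x => ∑ i ∈ t, f i x) (fun x => ∑ i ∈ t, mderivW s α (f i) x) s := by
  rw [← length_mlist] at hn
  unfold mderivW
  generalize mlist α = l at hn ⊢
  induction l with
  | nil => exact fun _ _ => rfl
  | cons j l ih =>
    have hn' : l.length + 1 ≤ n := by simpa using hn
    intro x hx
    rw [listD_cons, partialDW_congr (ih (by omega)) j hx]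
    simp only [partialDW, listD_cons]
    rw [fderivWithin_fun_sum (hs.uniqueDiffOn x hx), sum_apply]
    intro i hi
    exact (listD_contDiffOn hs (hf i hi) l (m := 1) (by omega)).differentiableOn
      (by norm_num) x hx

theorem mderivW_const {c : ℝ} {α : Fin d → ℕ} (hα : α ≠ 0) (x : E d) :
    mderivW s α (fun _ => c) x = 0 := by
  have h0 : ∀ l : List (Fin d), ∀ j, listD s (j :: l) (fun _ => c) = 0 := by
    intro l
    induction l with
    | nil => intro j; ext x; simp [listD_cons, partialDW]
    | cons i l ih =>
      intro j
      rw [listD_cons, ih i]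
      ext x; simp [partialDW]
  unfold mderivW
  cases h : mlist α with
  | nil =>
    exact absurd (funext fun j => by rw [← count_mlist α j, h]; rfl) hα
  | cons j l => rw [h0]; rfl

theorem exists_eq_add_single {α : Fin d → ℕ} (hα : α ≠ 0) :
    ∃ (β : Fin d → ℕ) (j : Fin d), α = β + Pi.single j 1 := by
  obtain ⟨j, hj⟩ : ∃ j, α j ≠ 0 := by
    by_contra! h
    exact hα (funext h)
  refine ⟨α - Pi.single j 1, j, funext fun i => ?_⟩
  by_cases h : i = j
  · subst h; simp; omega
  · simp [h]

theorem mchoose_eq_zero {α β : Fin d → ℕ} (h : ¬ β ≤ α) : mchoose α β = 0 := by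
  rw [Pi.le_def] at h
  push Not at h
  obtain ⟨j, hj⟩ := h
  exact Finset.prod_eq_zero (Finset.mem_univ j) (Nat.choose_eq_zero_of_lt hj)

theorem mchoose_zero_right (α : Fin d → ℕ) : mchoose α 0 = 1 := by simp [mchoose]

open Classical in
/-- Pascal's rule. -/
theorem mchoose_add_single (α β : Fin d → ℕ) (j : Fin d) :
    mchoose (α + Pi.single j 1) β =
      mchoose α β + if Pi.single j 1 ≤ β then mchoose α (β - Pi.single j 1) else 0 := by
  classical
  unfold mchoose
  rw [← Finset.mul_prod_erase _ _ (Finset.mem_univ j),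
    ← Finset.mul_prod_erase _ (fun i => (α i).choose (β i)) (Finset.mem_univ j),
    ← Finset.mul_prod_erase _ (fun i => (α i).choose ((β - (Pi.single j 1 : Fin d → ℕ)) i))
      (Finset.mem_univ j)]
  have h1 : ∏ i ∈ Finset.univ.erase j, ((α + (Pi.single j 1 : Fin d → ℕ)) i).choose (β i) =
      ∏ i ∈ Finset.univ.erase j, (α i).choose (β i) :=
    Finset.prod_congr rfl fun i hi => by simp [Finset.ne_of_mem_erase hi]
  have h2 : ∏ i ∈ Finset.univ.erase j, (α i).choose ((β - (Pi.single j 1 : Fin d → ℕ)) i) =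
      ∏ i ∈ Finset.univ.erase j, (α i).choose (β i) :=
    Finset.prod_congr rfl fun i hi => by simp [Finset.ne_of_mem_erase hi]
  have h3 : (Pi.single j 1 ≤ β) ↔ 1 ≤ β j := by
    constructor
    · intro h; simpa using h j
    · intro h i
      by_cases hi : i = j
      · subst hi; simpa using h
      · simp [hi]
  rw [h1, h2]
  simp only [h3]
  rcases Nat.eq_zero_or_pos (β j) with h | h
  · simp [h]
  · obtain ⟨b, hb⟩ : ∃ b, β j = b + 1 := ⟨β j - 1, by omega⟩
    simp [hb, Nat.choose_succ_succ]
    ring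

/-- The Leibniz rule for multi-index derivatives. -/
theorem mderivW_mul (hs : Fat s) {f g : E d → ℝ} {n : ℕ} (hf : ContDiffOn ℝ n f s)
    (hg : ContDiffOn ℝ n g s) (α : Fin d → ℕ) (hα : order α ≤ n) :
    EqOn (mderivW s α fun x => f x * g x)
      (fun x => ∑ β ∈ Finset.Iic α, (mchoose α β : ℝ) * mderivW s β f x * mderivW s (α - β) g x)
      s := by
  classical
  induction hk : order α generalizing α with
  | zero =>
    have h0 : α = 0 := by
      funext j
      have := Finset.sum_eq_zero_iff.1 hk j (Finset.mem_univ j)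
      simpa using this
    subst h0
    have : Finset.Iic (0 : Fin d → ℕ) = {0} := by
      ext β; simp
    intro x _
    simp [this, mchoose_zero_right]
  | succ k ih =>
    have hne : α ≠ 0 := by rintro rfl; simp [order] at hk
    obtain ⟨γ, j, rfl⟩ := exists_eq_add_single hne
    have hγk : order γ = k := by rw [order_add, order_single] at hk; omega
    have hγ1 : order γ + 1 ≤ n := by rw [order_add, order_single] at hα; exact hα
    intro x hx
    have hβ : ∀ β ∈ Finset.Iic γ, order β + 1 ≤ n := fun β h =>
      (Nat.add_le_add_right (order_mono (Finset.mem_Iic.1 h)) 1).trans hγ1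
    have hβ' : ∀ β ∈ Finset.Iic γ, order (γ - β) + 1 ≤ n := fun β h =>
      (Nat.add_le_add_right (order_mono (fun i => Nat.sub_le _ _)) 1).trans hγ1
    have hdiff : ∀ {F : E d → ℝ}, ContDiffOn ℝ n F s → ∀ β, order β + 1 ≤ n →
        DifferentiableWithinAt ℝ (mderivW s β F) s x := fun hF β hβ =>
      (mderivW_contDiffOn hs hF β (m := 1) (by omega)).differentiableOn (by norm_num) x hx
    rw [← partialDW_mderivW hs (hf.mul hg) hγ1 j hx,
      partialDW_congr (ih γ (by omega) hγk) j hx]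
    have hsum : partialDW s j (fun x => ∑ β ∈ Finset.Iic γ,
          (mchoose γ β : ℝ) * mderivW s β f x * mderivW s (γ - β) g x) x =
        ∑ β ∈ Finset.Iic γ, (mchoose γ β : ℝ) *
          (mderivW s (β + Pi.single j 1) f x * mderivW s (γ - β) g x +
            mderivW s β f x * mderivW s (γ - β + Pi.single j 1) g x) := by
      simp only [partialDW]
      rw [fderivWithin_fun_sum (hs.uniqueDiffOn x hx), sum_apply]
      · refine Finset.sum_congr rfl fun β h => ?_
        have e1 := partialDW_mderivW hs hf (hβ β h) j hx
        have e2 := partialDW_mderivW hs hg (hβ' β h) j hx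
        simp only [partialDW] at e1 e2
        rw [← e1, ← e2]
        simp only [mul_assoc]
        rw [fderivWithin_const_mul (hs.uniqueDiffOn x hx),
          fderivWithin_fun_mul (hs.uniqueDiffOn x hx)
          (hdiff hf β (hβ β h)) (hdiff hg _ (hβ' β h))]
        · simp
          ring
        · exact (hdiff hf β (hβ β h)).mul (hdiff hg _ (hβ' β h))
      · intro β h
        exact ((hdiff hf β (hβ β h)).const_mul _).mul (hdiff hg _ (hβ' β h))
    rw [hsum]
    simp only [mul_add, Finset.sum_add_distrib, mchoose_add_single, Nat.cast_add, add_mul]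
    rw [add_comm]
    congr 1
    · -- indices outside `β ≤ γ` carry a vanishing binomial coefficient
      rw [← Finset.sum_subset (Finset.Iic_subset_Iic.2 (le_add_of_nonneg_right zero_le :
        γ ≤ γ + Pi.single j 1))]
      · refine Finset.sum_congr rfl fun β h => ?_
        rw [tsub_add_eq_add_tsub (Finset.mem_Iic.1 h)]
        ring
      · intro β _ h
        rw [mchoose_eq_zero (by simpa using h)]
        simp
    · -- the shift `β ↦ β + e_j` maps onto the indices with `β_j ≥ 1`
      rw [← Finset.sum_filter_add_sum_filter_not (Finset.Iic (γ + Pi.single j 1))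
        (fun β => Pi.single j 1 ≤ β)]
      rw [Finset.sum_eq_zero (s := Finset.filter (fun β => ¬ Pi.single j 1 ≤ β) _), add_zero]
      · refine Finset.sum_nbij' (fun β => β + Pi.single j 1) (fun β => β - Pi.single j 1)
          ?_ ?_ ?_ ?_ ?_
        · intro β h
          simpa using h
        · intro β h
          simp only [Finset.mem_filter, Finset.mem_Iic] at h
          simpa using h.1
        · intro β _; simp
        · intro β h
          simp only [Finset.mem_filter, Finset.mem_Iic] at h
          exact tsub_add_cancel_of_le h.2
        · intro β _
          simp only [le_add_iff_nonneg_left, zero_le, if_true, add_tsub_cancel_right,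
            add_tsub_add_eq_tsub_right]
          ring
      · intro β h
        simp only [Finset.mem_filter] at h
        simp [h.2]

theorem Iic_eq_insert (α : Fin d → ℕ) : Finset.Iic α = insert 0 (Finset.Ioc 0 α) := by
  ext β
  simp only [Finset.mem_Iic, Finset.mem_insert, Finset.mem_Ioc]
  constructor
  · intro h
    rcases eq_or_ne β 0 with h0 | h0
    · exact Or.inl h0
    · exact Or.inr ⟨pos_iff_ne_zero.2 h0, h⟩
  · rintro (rfl | h)
    · exact zero_le
    · exact h.2

theorem mderivW_sub (hs : Fat s) {f g : E d → ℝ} {n : ℕ} (hf : ContDiffOn ℝ n f s)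
    (hg : ContDiffOn ℝ n g s) {α : Fin d → ℕ} (hn : order α ≤ n) :
    EqOn (mderivW s α fun x => f x - g x) (fun x => mderivW s α f x - mderivW s α g x) s := by
  rw [← length_mlist] at hn
  unfold mderivW
  generalize mlist α = l at hn ⊢
  induction l with
  | nil => exact fun _ _ => rfl
  | cons j l ih =>
    have hn' : l.length + 1 ≤ n := by simpa using hn
    intro x hx
    have hd : ∀ {F : E d → ℝ}, ContDiffOn ℝ n F s → DifferentiableWithinAt ℝ (listD s l F) s x :=
      fun hF => (listD_contDiffOn hs hF l (m := 1) (by omega)).differentiableOn (by norm_num) x hx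
    rw [listD_cons, partialDW_congr (ih (by omega)) j hx]
    simp only [partialDW, listD_cons]
    rw [fderivWithin_fun_sub (hs.uniqueDiffOn x hx) (hd hf) (hd hg), sub_apply]

theorem mderivW_eq_mderiv (hs : Fat s) {g : E d → ℝ} {α : Fin d → ℕ}
    (hg : ContDiff ℝ (order α) g) : EqOn (mderivW s α g) (mderiv α g) s := by
  rw [mderiv_eq_mderivW_univ]
  unfold mderivW
  have hn : (mlist α).length ≤ order α := (length_mlist α).le
  generalize mlist α = l at hn ⊢
  induction l with
  | nil => exact fun _ _ => rfl
  | cons j l ih =>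
    have hn' : l.length + 1 ≤ order α := by simpa using hn
    intro x hx
    rw [listD_cons, listD_cons, partialDW_congr (ih (by omega)) j hx]
    have hd := (listD_contDiffOn isOpen_univ.fat hg.contDiffOn l (m := 1)
      (by omega)).differentiableOn (by norm_num) x (mem_univ x)
    simp only [partialDW, fderivWithin_univ]
    rw [fderivWithin_eq_fderiv (hs.uniqueDiffOn x hx) (differentiableWithinAt_univ.1 hd)]

theorem finite_order_le (n : ℕ) : {α : Fin d → ℕ | order α ≤ n}.Finite := by
  refine (Set.finite_Iic (fun _ : Fin d => n)).subset fun α hα j => ?_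
  exact (Finset.single_le_sum (f := α) (fun _ _ => Nat.zero_le _) (Finset.mem_univ j)).trans hα

/-- Constants that depend on a multi-index of bounded order can be replaced by a common one. -/
theorem exists_uniform_const {n : ℕ} {q : (Fin d → ℕ) → ℝ → Prop}
    (hmono : ∀ α C C', C ≤ C' → q α C → q α C') (h : ∀ α, order α ≤ n → ∃ C, q α C) :
    ∃ C, 0 ≤ C ∧ ∀ α, order α ≤ n → q α C := by
  choose! c hc using h
  obtain ⟨B, hB⟩ := ((finite_order_le (d := d) n).image c).bddAbove
  exact ⟨max B 0, le_max_right _ _, fun α hα => hmono α _ _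
    ((hB (mem_image_of_mem c hα)).trans (le_max_left _ _)) (hc α hα)⟩

theorem order_sub {α β : Fin d → ℕ} (h : β ≤ α) : order (α - β) + order β = order α := by
  rw [← order_add, tsub_add_cancel_of_le h]

end Calculus

/-! ### Derivatives and coefficients of polynomials -/

section Polynomials

variable {d : ℕ}

theorem peval_add (q q' : MvPolynomial (Fin d) ℝ) (x : E d) :
    peval (q + q') x = peval q x + peval q' x := by simp [peval]

theorem peval_sub (q q' : MvPolynomial (Fin d) ℝ) (x : E d) :
    peval (q - q') x = peval q x - peval q' x := by simp [peval]

theorem peval_sum {ι : Type*} (t : Finset ι) (q : ι → MvPolynomial (Fin d) ℝ) (x : E d) :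
    peval (∑ i ∈ t, q i) x = ∑ i ∈ t, peval (q i) x := by simp [peval]

theorem peval_zero_eq_coeff (q : MvPolynomial (Fin d) ℝ) :
    peval q (0 : E d) = MvPolynomial.coeff 0 q := by
  rw [← MvPolynomial.constantCoeff_eq, ← MvPolynomial.eval_zero]
  rfl

theorem contDiff_peval (q : MvPolynomial (Fin d) ℝ) {n : WithTop ℕ∞} :
    ContDiff ℝ n (fun x : E d => peval q x) := by
  unfold peval
  induction q using MvPolynomial.induction_on with
  | C a => simpa using contDiff_const
  | add p q hp hq => simpa using hp.add hq
  | mul_X p i hp => simpa using hp.mul (by fun_prop)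

theorem partialD_peval (q : MvPolynomial (Fin d) ℝ) (j : Fin d) (x : E d) :
    partialD j (fun x => peval q x) x = peval (MvPolynomial.pderiv j q) x := by
  have hdiff : ∀ q : MvPolynomial (Fin d) ℝ, DifferentiableAt ℝ (fun x : E d => peval q x) x :=
    fun q => (contDiff_peval q (n := 1)).differentiable (by norm_num) x
  induction q using MvPolynomial.induction_on with
  | C a => simp [peval, partialD]
  | add p q hp hq =>
    simp only [partialD, peval_add, map_add] at hp hq ⊢
    rw [fderiv_fun_add (hdiff p) (hdiff q), add_apply, hp, hq]
  | mul_X p i hp =>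
    have h1 : ∀ x : E d, peval (p * MvPolynomial.X i) x = peval p x * x i := fun x => by
      simp [peval]
    simp only [partialD, h1] at hp ⊢
    have hi : HasFDerivAt (fun x : E d => x i) (EuclideanSpace.proj (𝕜 := ℝ) i) x :=
      (EuclideanSpace.proj (𝕜 := ℝ) i).hasFDerivAt
    rw [fderiv_fun_mul (hdiff p) hi.differentiableAt, hi.fderiv]
    simp only [add_apply, smul_apply, hp, Derivation.leibniz, MvPolynomial.pderiv_X]
    by_cases hij : i = j
    · subst hij; simp [peval]
    · simp [peval, hij]

/-- The iterated formal partial derivative along a list of directions. -/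
noncomputable def pderivL (l : List (Fin d)) (q : MvPolynomial (Fin d) ℝ) :
    MvPolynomial (Fin d) ℝ :=
  l.foldr (fun j q => MvPolynomial.pderiv j q) q

theorem pderivL_cons (j : Fin d) (l : List (Fin d)) (q : MvPolynomial (Fin d) ℝ) :
    pderivL (j :: l) q = MvPolynomial.pderiv j (pderivL l q) := rfl

theorem pderivL_add (l : List (Fin d)) (q q' : MvPolynomial (Fin d) ℝ) :
    pderivL l (q + q') = pderivL l q + pderivL l q' := by
  induction l with
  | nil => rfl
  | cons j l ih => rw [pderivL_cons, ih, map_add]; rfl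

theorem pderivL_smul (l : List (Fin d)) (c : ℝ) (q : MvPolynomial (Fin d) ℝ) :
    pderivL l (c • q) = c • pderivL l q := by
  induction l with
  | nil => rfl
  | cons j l ih => rw [pderivL_cons, ih, Derivation.map_smul]; rfl

/-- The formal derivative of multi-index `α`, as a linear map. -/
noncomputable def mpderiv (α : Fin d → ℕ) :
    MvPolynomial (Fin d) ℝ →ₗ[ℝ] MvPolynomial (Fin d) ℝ where
  toFun := pderivL (mlist α)
  map_add' := pderivL_add _
  map_smul' := pderivL_smul _

theorem mderiv_peval_comp_affine (q : MvPolynomial (Fin d) ℝ) (c : ℝ) (a : E d)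
    (α : Fin d → ℕ) (x : E d) :
    mderiv α (fun x => peval q (c • (x - a))) x =
      c ^ order α * peval (mpderiv α q) (c • (x - a)) := by
  rw [mderiv_eq_mderivW_univ, mderivW, ← length_mlist]
  change _ = _ * peval (pderivL (mlist α) q) _
  generalize mlist α = l
  induction l generalizing x with
  | nil => simp [pderivL]
  | cons j l ih =>
    rw [listD_cons, partialDW_univ, funext ih, pderivL_cons, ← partialD_peval]
    simp only [partialD, List.length_cons]
    have h1 : HasFDerivAt (fun x : E d => c • (x - a)) (c • ContinuousLinearMap.id ℝ (E d)) x :=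
      ((hasFDerivAt_id x).sub_const a).const_smul c
    have h2 : HasFDerivAt (fun x : E d => peval (pderivL l q) x) _ (c • (x - a)) :=
      ((contDiff_peval (pderivL l q) (n := 1)).differentiable (by norm_num) _).hasFDerivAt
    have h3 := ((h2.comp x h1).const_mul (c ^ l.length)).fderiv
    have h4 : (fun x => c ^ l.length * peval (pderivL l q) (c • (x - a))) =
      fun x => c ^ l.length * ((fun x => peval (pderivL l q) x) ∘ fun x => c • (x - a)) x := rfl
    rw [h4, h3]
    simp
    ring

/-- Polynomials that agree on a set with interior points are equal. -/
theorem eq_of_peval_eq {q q' : MvPolynomial (Fin d) ℝ} {s : Set (E d)}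
    (hs : (interior s).Nonempty) (h : ∀ x ∈ s, peval q x = peval q' x) : q = q' := by
  obtain ⟨x₀, hx₀⟩ := hs
  -- in the topology of `ℝ^d` as a product, the interior contains an open box
  let e := EuclideanSpace.equiv (Fin d) ℝ
  have ho : IsOpen (e.symm ⁻¹' interior s) := isOpen_interior.preimage e.symm.continuous
  have hm : e x₀ ∈ e.symm ⁻¹' interior s := by simpa using hx₀
  obtain ⟨ε, hε, hb⟩ := Metric.isOpen_iff.1 ho _ hm
  refine MvPolynomial.funext_set (fun i => Metric.ball (e x₀ i) ε) (fun i => ?_) fun y hy => ?_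
  · rw [Real.ball_eq_Ioo]
    exact Ioo_infinite (by linarith)
  · have hy' : y ∈ Metric.ball (e x₀) ε := by rw [ball_pi _ hε]; exact hy
    exact h (e.symm y) (interior_subset (hb hy'))

/-- The exponent of the monomial whose derivative along `l` is constant. -/
noncomputable def listExp (l : List (Fin d)) : Fin d →₀ ℕ :=
  Finsupp.equivFunOnFinite.symm fun j => l.count j

theorem degree_eq_sum (m : Fin d →₀ ℕ) : m.degree = ∑ j, m j := by
  rw [Finsupp.degree_eq_sum]

/-- The coefficient of a derivative is a nonzero multiple of the correspondingly shifted
coefficient. -/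
theorem exists_coeff_pderivL (l : List (Fin d)) (m : Fin d →₀ ℕ) :
    ∃ c : ℝ, c ≠ 0 ∧ ∀ q, MvPolynomial.coeff m (pderivL l q) =
      c * MvPolynomial.coeff (m + listExp l) q := by
  induction l generalizing m with
  | nil =>
    refine ⟨1, one_ne_zero, fun q => ?_⟩
    have : listExp ([] : List (Fin d)) = 0 := by ext j; simp [listExp]
    simp [this, pderivL]
  | cons j l ih =>
    obtain ⟨c, hc, h⟩ := ih (m + Finsupp.single j 1)
    refine ⟨c * (m j + 1), mul_ne_zero hc (by positivity), fun q => ?_⟩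
    have : m + listExp (j :: l) = m + Finsupp.single j 1 + listExp l := by
      ext i
      simp [listExp, List.count_cons, Finsupp.single_apply]
      ring
    rw [pderivL_cons, MvPolynomial.coeff_pderiv, h, this]
    ring

theorem listExp_mlist (α : Fin d → ℕ) :
    listExp (mlist α) = Finsupp.equivFunOnFinite.symm α := by
  ext j; simp [listExp, count_mlist]

theorem degree_symm (α : Fin d → ℕ) :
    (Finsupp.equivFunOnFinite.symm α).degree = order α := by
  rw [degree_eq_sum]; rfl

theorem coeff_eq_zero_of_mem_Poly {p : ℕ} {q : MvPolynomial (Fin d) ℝ} (hq : q ∈ Poly d p)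
    {m : Fin d →₀ ℕ} (hm : p < m.degree) : MvPolynomial.coeff m q = 0 := by
  rw [MvPolynomial.mem_restrictTotalDegree] at hq
  refine MvPolynomial.coeff_eq_zero_of_totalDegree_lt ?_
  exact lt_of_le_of_lt hq hm

theorem mpderiv_eq_zero {p : ℕ} {q : MvPolynomial (Fin d) ℝ} (hq : q ∈ Poly d p)
    {α : Fin d → ℕ} (hα : p < order α) : mpderiv α q = 0 := by
  ext m
  obtain ⟨c, -, h⟩ := exists_coeff_pderivL (mlist α) m
  refine (h q).trans ?_
  rw [coeff_eq_zero_of_mem_Poly hq, mul_zero, MvPolynomial.coeff_zero]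
  rw [listExp_mlist, map_add, degree_symm]
  omega

/-- The exponents of the monomials of degree at most `p`. -/
noncomputable def exps (d p : ℕ) : Finset (Fin d →₀ ℕ) :=
  (Finsupp.finite_of_degree_le (σ := Fin d) p).toFinset

theorem mem_exps {p : ℕ} {m : Fin d →₀ ℕ} : m ∈ exps d p ↔ m.degree ≤ p := by
  simp [exps]

theorem eq_sum_exps {p : ℕ} {q : MvPolynomial (Fin d) ℝ} (hq : q ∈ Poly d p) :
    q = ∑ m ∈ exps d p, MvPolynomial.coeff m q • MvPolynomial.monomial m (1 : ℝ) := by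
  classical
  ext n
  simp only [MvPolynomial.coeff_sum, MvPolynomial.coeff_smul, MvPolynomial.coeff_monomial,
    smul_eq_mul, mul_ite, mul_one, mul_zero, Finset.sum_ite_eq']
  split_ifs with h
  · rfl
  · exact coeff_eq_zero_of_mem_Poly hq (by simpa [mem_exps] using h)

/-- A polynomial of degree at most `p` can be given arbitrary derivatives of order at most `p` at
the origin. -/
theorem exists_poly_with_derivs (p : ℕ) (V : (Fin d → ℕ) → ℝ) :
    ∃ r ∈ Poly d p, ∀ α, order α ≤ p → peval (mpderiv α r) (0 : E d) = V α := by
  classical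
  choose c hc h using fun α : Fin d → ℕ => exists_coeff_pderivL (mlist α) 0
  refine ⟨∑ m ∈ exps d p, MvPolynomial.monomial m (V m / c m), ?_, fun α hα => ?_⟩
  · refine Submodule.sum_mem _ fun m hm => ?_
    rw [MvPolynomial.mem_restrictTotalDegree]
    exact (MvPolynomial.totalDegree_monomial_le _ _).trans (mem_exps.1 hm)
  · rw [peval_zero_eq_coeff]
    refine (h α _).trans ?_
    rw [zero_add, listExp_mlist, MvPolynomial.coeff_sum]
    simp only [MvPolynomial.coeff_monomial, Finset.sum_ite_eq']
    rw [if_pos (mem_exps.2 (by rwa [degree_symm]))]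
    simp only [Finsupp.coe_equivFunOnFinite_symm]
    field_simp [hc α]

/-- A derivative of a polynomial is bounded on bounded sets by its coefficients. -/
theorem exists_bound_mpderiv (p : ℕ) (α : Fin d → ℕ) (r : ℝ) :
    ∃ C : ℝ, 0 ≤ C ∧ ∀ q ∈ Poly d p, ∀ A : ℝ, (∀ m, |MvPolynomial.coeff m q| ≤ A) →
      ∀ x : E d, ‖x‖ ≤ r → |peval (mpderiv α q) x| ≤ C * A := by
  have hb : ∀ m : Fin d →₀ ℕ, ∃ B : ℝ, ∀ x : E d, ‖x‖ ≤ r →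
      |peval (mpderiv α (MvPolynomial.monomial m (1 : ℝ))) x| ≤ B := fun m => by
    obtain ⟨B, hB⟩ := (isCompact_closedBall (0 : E d) r).exists_bound_of_continuousOn
      (contDiff_peval (mpderiv α (MvPolynomial.monomial m (1 : ℝ)))
        (n := 0)).continuous.continuousOn
    exact ⟨B, fun x hx => hB x (by simpa using hx)⟩
  choose B hB using hb
  refine ⟨∑ m ∈ exps d p, |B m|, Finset.sum_nonneg fun _ _ => abs_nonneg _,
    fun q hq A hA x hx => ?_⟩
  conv_lhs => rw [eq_sum_exps hq]
  rw [map_sum, peval_sum, Finset.sum_mul]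
  refine (Finset.abs_sum_le_sum_abs _ _).trans (Finset.sum_le_sum fun m _ => ?_)
  have : peval (mpderiv α (MvPolynomial.coeff m q • MvPolynomial.monomial m (1 : ℝ))) x =
      MvPolynomial.coeff m q * peval (mpderiv α (MvPolynomial.monomial m (1 : ℝ))) x := by
    rw [map_smul]; simp [peval]
  rw [this, abs_mul, mul_comm]
  exact mul_le_mul ((hB m x hx).trans (le_abs_self _)) (hA m) (abs_nonneg _) (abs_nonneg _)

/-- Polynomials of degree at most `p` are stable under affine changes of the variable. -/
theorem exists_peval_scaled {p : ℕ} {P : MvPolynomial (Fin d) ℝ} (hP : P ∈ Poly d p) (a : E d)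
    {ρ : ℝ} (hρ : ρ ≠ 0) :
    ∃ r ∈ Poly d p, ∀ x, peval r (ρ⁻¹ • (x - a)) = peval P x := by
  let g : Fin d → MvPolynomial (Fin d) ℝ := fun j =>
    MvPolynomial.C (a j) + MvPolynomial.C ρ * MvPolynomial.X j
  have hg : ∀ j, (g j).totalDegree ≤ 1 := fun j => by
    refine (MvPolynomial.totalDegree_add _ _).trans (max_le (by simp) ?_)
    exact (MvPolynomial.totalDegree_mul _ _).trans (by simp)
  refine ⟨MvPolynomial.aeval g P, ?_, fun x => ?_⟩
  · rw [MvPolynomial.mem_restrictTotalDegree] at hP ⊢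
    rw [MvPolynomial.aeval_def, MvPolynomial.eval₂_eq]
    refine MvPolynomial.totalDegree_finsetSum_le fun m hm => ?_
    refine (MvPolynomial.totalDegree_mul _ _).trans ?_
    rw [MvPolynomial.algebraMap_eq, MvPolynomial.totalDegree_C, zero_add]
    refine (MvPolynomial.totalDegree_finsetProd _ _).trans ?_
    refine le_trans (Finset.sum_le_sum (g := fun i => m i) fun i _ => ?_)
      ((MvPolynomial.le_totalDegree hm).trans hP)
    exact (MvPolynomial.totalDegree_pow _ _).trans (by nlinarith [hg i])
  · unfold peval
    rw [← MvPolynomial.coe_aeval_eq_eval, ← MvPolynomial.coe_aeval_eq_eval]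
    simp only [RingHom.coe_coe]
    rw [← AlgHom.comp_apply, MvPolynomial.comp_aeval]
    congr 2
    funext j
    simp only [g, map_add, map_mul, MvPolynomial.aeval_C, MvPolynomial.aeval_X]
    simp
    field_simp
    ring

end Polynomials

/-! ### Element shape functions and the geometry of a mesh -/

namespace Mesh

variable {d : ℕ} {Ω : Set (E d)} {κ : Type*} {R : κ → RefElement d} (M : Mesh Ω R)

theorem cell_subset (T : Fin M.nCells) : M.cell T ⊆ closure Ω := by
  rw [← M.cover]
  exact subset_iUnion (fun T => M.map T '' (R (M.kind T)).carrier) T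

theorem exists_mem_cell {x : E d} (hx : x ∈ closure Ω) : ∃ T, x ∈ M.cell T := by
  rw [← M.cover] at hx
  exact mem_iUnion.1 hx

theorem isCompact_cell (T : Fin M.nCells) : IsCompact (M.cell T) :=
  (R (M.kind T)).isCompact.image_of_continuousOn fun a ha =>
    (M.map_smooth T a ha).continuousAt.continuousWithinAt

theorem node_conn_mem_cell (T : Fin M.nCells) (a) : M.node (M.conn T a) ∈ M.cell T := by
  rw [M.node_conn]
  exact mem_image_of_mem _ ((R (M.kind T)).pt_mem a)

theorem node_mem_closure (i : Fin M.nNodes) : M.node i ∈ closure Ω := by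
  obtain ⟨T, a, rfl⟩ := M.conn_surjective i
  exact M.cell_subset T (M.node_conn_mem_cell T a)

theorem mem_layer_zero {i : Fin M.nNodes} {T : Fin M.nCells} :
    T ∈ M.layer i 0 ↔ M.node i ∈ M.cell T := by
  simp [layer]

theorem mem_layer_succ {i : Fin M.nNodes} {s : ℕ} {T : Fin M.nCells} :
    T ∈ M.layer i (s + 1) ↔ ∃ T' ∈ M.layer i s, (M.cell T ∩ M.cell T').Nonempty := by
  simp [layer]

/-- The open set of points near which the coordinate map of the element `T` is of class `C^n`. -/
def smoothDom (T : Fin M.nCells) (n : ℕ) : Set (E d) := {y | ContDiffAt ℝ n (M.coord T) y}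

theorem isOpen_smoothDom (T : Fin M.nCells) (n : ℕ) : IsOpen (M.smoothDom T n) :=
  isOpen_iff_mem_nhds.2 fun _ hx => ContDiffAt.eventually hx (by simp)

theorem cell_subset_smoothDom (T : Fin M.nCells) (n : ℕ) : M.cell T ⊆ M.smoothDom T n := by
  rintro _ ⟨a, ha, rfl⟩
  change ContDiffAt ℝ n (M.coord T) (M.map T a)
  exact (M.coord_smooth T a ha).of_le (by exact_mod_cast (le_top : (n : ℕ∞) ≤ ⊤))

theorem coord_contDiffOn (T : Fin M.nCells) (n : ℕ) :
    ContDiffOn ℝ n (M.coord T) (M.smoothDom T n) := fun _ hx => ContDiffAt.contDiffWithinAt hx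

/-- The shape function of the local node `a` transported to the element `T`. -/
noncomputable def elemShape (T : Fin M.nCells) (a : Fin (R (M.kind T)).card) (x : E d) : ℝ :=
  peval ((R (M.kind T)).shape a) (M.coord T x)

theorem elemShape_contDiffOn (T : Fin M.nCells) (a) (n : ℕ) :
    ContDiffOn ℝ n (M.elemShape T a) (M.smoothDom T n) :=
  (contDiff_peval _).comp_contDiffOn (M.coord_contDiffOn T n)

theorem localShape_eq (T : Fin M.nCells) (i : Fin M.nNodes) :
    M.localShape T i = fun x => ∑ a ∈ Finset.univ.filter (fun a => M.conn T a = i),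
      M.elemShape T a x := by
  ext x
  rw [Finset.sum_filter]
  rfl

theorem localShape_contDiffOn (T : Fin M.nCells) (i) (n : ℕ) :
    ContDiffOn ℝ n (M.localShape T i) (M.smoothDom T n) := by
  rw [localShape_eq]
  exact ContDiffOn.sum fun a _ => M.elemShape_contDiffOn T a n

/-- The shape functions of a reference element sum to one as polynomials, so the transported ones
sum to one wherever they are evaluated. -/
theorem sum_elemShape (T : Fin M.nCells) (x : E d) : ∑ a, M.elemShape T a x = 1 := by
  have h : ∑ a, (R (M.kind T)).shape a = MvPolynomial.C 1 :=
    eq_of_peval_eq (R (M.kind T)).interior_nonempty fun x hx => by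
      rw [peval_sum, (R (M.kind T)).sum_shape x hx]
      simp [peval]
  unfold elemShape
  rw [← peval_sum, h]
  simp [peval]

/-- Summation over global nodes reduces to summation over the nodes of the element. -/
theorem sum_mderiv_localShape_mul {T : Fin M.nCells} {n : ℕ} {x : E d}
    (hx : x ∈ M.smoothDom T n) {β : Fin d → ℕ} (hβ : order β ≤ n) (c : Fin M.nNodes → ℝ) :
    ∑ i, mderiv β (M.localShape T i) x * c i =
      ∑ a, mderiv β (M.elemShape T a) x * c (M.conn T a) := by
  have ho := M.isOpen_smoothDom T n
  have h : ∀ i, mderiv β (M.localShape T i) x * c i =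
      ∑ a, if M.conn T a = i then mderiv β (M.elemShape T a) x * c (M.conn T a) else 0 := by
    intro i
    rw [localShape_eq, mderiv_eqOn_mderivW ho _ β hx,
      mderivW_sum ho.fat _ (fun a _ => M.elemShape_contDiffOn T a n) hβ hx, Finset.sum_mul,
      Finset.sum_filter]
    refine Finset.sum_congr rfl fun a _ => ?_
    split_ifs with h
    · rw [mderiv_eqOn_mderivW ho _ β hx, h]
    · rfl
  simp only [h]
  rw [Finset.sum_comm]
  simp

theorem sum_mderiv_elemShape {T : Fin M.nCells} {n : ℕ} {x : E d}
    (hx : x ∈ M.smoothDom T n) {β : Fin d → ℕ} (hβ : order β ≤ n) (hβ0 : β ≠ 0) :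
    ∑ a, mderiv β (M.elemShape T a) x = 0 := by
  have ho := M.isOpen_smoothDom T n
  calc ∑ a, mderiv β (M.elemShape T a) x
      = ∑ a, mderivW (M.smoothDom T n) β (M.elemShape T a) x :=
        Finset.sum_congr rfl fun a _ => mderiv_eqOn_mderivW ho _ β hx
    _ = mderivW (M.smoothDom T n) β (fun x => ∑ a, M.elemShape T a x) x :=
        (mderivW_sum ho.fat _ (fun a _ => M.elemShape_contDiffOn T a n) hβ hx).symm
    _ = 0 := by simp only [sum_elemShape]; exact mderivW_const hβ0 x

theorem sum_N {x : E d} (hx : x ∈ closure Ω) : ∑ i, M.N i x = 1 := by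
  obtain ⟨T, hT⟩ := M.exists_mem_cell hx
  simp only [M.N_eq_localShape _ hT]
  have h := M.sum_mderiv_localShape_mul (M.cell_subset_smoothDom T 0 hT) (β := 0)
    (by simp [order]) (fun _ => 1)
  simpa [mderiv_eq_mderivW_univ, sum_elemShape] using h

theorem continuousOn_N (i : Fin M.nNodes) : ContinuousOn (M.N i) (closure Ω) := by
  rw [← M.cover]
  refine (locallyFinite_of_finite _).continuousOn_iUnion
    (fun T => (M.isCompact_cell T).isClosed) fun T => ?_
  refine ContinuousOn.congr (f := M.localShape T i) ?_ fun x hx => M.N_eq_localShape i hx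
  exact (M.localShape_contDiffOn T i 0).continuousOn.mono (M.cell_subset_smoothDom T 0)

theorem eqOn_N_interior (i : Fin M.nNodes) (T : Fin M.nCells) :
    EqOn (M.N i) (M.localShape T i) (interior (M.cell T)) := fun _ hx =>
  M.N_eq_localShape i (interior_subset hx)

/-- Closures of meshed domains admit unique derivatives, since every point lies in a diffeomorphic
image of a convex body. -/
theorem fat_closure (M : Mesh Ω R) (hΩ : IsOpen Ω) : Fat (closure Ω) := by
  refine ⟨fun x hx => ?_, closure_mono (interior_maximal subset_closure hΩ)⟩
  obtain ⟨T, a, ha, rfl⟩ := M.exists_mem_cell hx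
  have hK := uniqueDiffOn_convex (R (M.kind T)).convex (R (M.kind T)).interior_nonempty a ha
  have hF : HasFDerivAt (M.map T) (fderiv ℝ (M.map T) a) a :=
    ((M.map_smooth T a ha).differentiableAt (by simp)).hasFDerivAt
  have hG : HasFDerivAt (M.coord T) (fderiv ℝ (M.coord T) (M.map T a)) (M.map T a) :=
    ((M.coord_smooth T a ha).differentiableAt (by simp)).hasFDerivAt
  have hid : HasFDerivWithinAt (M.coord T ∘ M.map T) (ContinuousLinearMap.id ℝ (E d))
      (R (M.kind T)).carrier a :=
    (hasFDerivWithinAt_id a _).congr (fun b hb => M.coord_map T b hb) (M.coord_map T a ha)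
  have hcomp := hK.eq (hG.comp_hasFDerivWithinAt a hF.hasFDerivWithinAt) hid
  have hinj : Function.Injective (fderiv ℝ (M.map T) a) := fun v w hvw => by
    have := congrArg (fderiv ℝ (M.coord T) (M.map T a)) hvw
    rw [← ContinuousLinearMap.comp_apply, ← ContinuousLinearMap.comp_apply, hcomp] at this
    exact this
  have hsurj : Function.Surjective (fderiv ℝ (M.map T) a) :=
    (LinearMap.injective_iff_surjective (f := (fderiv ℝ (M.map T) a).toLinearMap)).1 hinj
  exact (hF.hasFDerivWithinAt.uniqueDiffWithinAt hK hsurj.denseRange).mono (M.cell_subset T)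

/-- The Leibniz remainder of `∑ N_i g_i` computed with the smooth shape functions of one element;
it makes sense up to the boundary of the element. -/
noncomputable def elemRemainder (T : Fin M.nCells) (α : Fin d → ℕ) (g : Fin M.nNodes → E d → ℝ)
    (x : E d) : ℝ :=
  ∑ i, ∑ β ∈ Finset.Ioc 0 α,
    (mchoose α β : ℝ) * mderiv β (M.localShape T i) x * mderiv (α - β) (g i) x

theorem mderiv_sum_localShape_mul {T : Fin M.nCells} {α : Fin d → ℕ}
    {g : Fin M.nNodes → E d → ℝ} (hg : ∀ i, ContDiff ℝ (order α) (g i)) {x : E d}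
    (hx : x ∈ M.smoothDom T (order α)) :
    mderiv α (fun y => ∑ i, M.localShape T i y * g i y) x =
      ∑ i, M.localShape T i x * mderiv α (g i) x + M.elemRemainder T α g x := by
  have ho := M.isOpen_smoothDom T (order α)
  have hs := fun i => M.localShape_contDiffOn T i (order α)
  rw [mderiv_eqOn_mderivW ho _ α hx,
    mderivW_sum ho.fat _ (fun i _ => (hs i).mul (hg i).contDiffOn) le_rfl hx, elemRemainder,
    ← Finset.sum_add_distrib]
  refine Finset.sum_congr rfl fun i _ => ?_
  rw [mderivW_mul ho.fat (hs i) (hg i).contDiffOn α le_rfl hx]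
  beta_reduce
  rw [Iic_eq_insert, Finset.sum_insert (by simp)]
  congr 1
  · rw [mderiv_eqOn_mderivW ho _ α hx]
    simp [mchoose_zero_right]
  · refine Finset.sum_congr rfl fun β _ => ?_
    rw [mderiv_eqOn_mderivW ho _ β hx, mderiv_eqOn_mderivW ho _ (α - β) hx]

/-- As derivatives of the partition of unity sum to zero, the remainder only sees the deviations of
the derivatives of the `g_i` from values `c γ` common to all nodes. -/
theorem elemRemainder_eq {T : Fin M.nCells} {α : Fin d → ℕ} {g : Fin M.nNodes → E d → ℝ}
    {x : E d} (hx : x ∈ M.smoothDom T (order α)) (c : (Fin d → ℕ) → ℝ) :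
    M.elemRemainder T α g x = ∑ β ∈ Finset.Ioc 0 α, (mchoose α β : ℝ) *
      ∑ a, mderiv β (M.elemShape T a) x * (mderiv (α - β) (g (M.conn T a)) x - c (α - β)) := by
  unfold elemRemainder
  rw [Finset.sum_comm]
  refine Finset.sum_congr rfl fun β hβ => ?_
  rw [Finset.mem_Ioc] at hβ
  have hβo := order_mono hβ.2
  simp only [mul_assoc]
  rw [← Finset.mul_sum, M.sum_mderiv_localShape_mul hx hβo]
  simp only [mul_sub, Finset.sum_sub_distrib]
  rw [← Finset.sum_mul, M.sum_mderiv_elemShape hx hβo hβ.1.ne', zero_mul, mul_zero, sub_zero]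

end Mesh

/-! ### Leibniz decomposition, continuity and jumps -/

namespace Disc

variable {d : ℕ} {Ω : Set (E d)} {κ : Type*} {R : κ → RefElement d} (D : Disc Ω R)

theorem U_contDiff (p : ℕ) (v : Fin D.nNodes → ℝ) (i) {n : WithTop ℕ∞} :
    ContDiff ℝ n (D.U p v i) :=
  (contDiff_peval _).comp ((contDiff_id.sub contDiff_const).const_smul _)

theorem mderiv_U (p : ℕ) (v : Fin D.nNodes → ℝ) (i) (α : Fin d → ℕ) (x : E d) :
    mderiv α (D.U p v i) x =
      (D.ρ i)⁻¹ ^ order α * peval (mpderiv α (D.recon p v i)) (D.ξ i x) :=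
  mderiv_peval_comp_affine _ _ _ α x

theorem continuousOn_intrinsic (p : ℕ) (v : Fin D.nNodes → ℝ) (α : Fin d → ℕ) :
    ContinuousOn (D.intrinsic p v α) (closure Ω) := by
  refine continuousOn_finsetSum _ fun i _ => (D.continuousOn_N i).mul ?_
  rw [funext (D.mderiv_U p v i α)]
  refine (continuous_const.mul ?_).continuousOn
  have hξ : Continuous (D.ξ i) := (continuous_id.sub continuous_const).const_smul (D.ρ i)⁻¹
  exact (contDiff_peval (n := 0) _).continuous.comp hξ

theorem remainder_eq_elemRemainder (p : ℕ) (v : Fin D.nNodes → ℝ) (α : Fin d → ℕ)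
    {T : Fin D.nCells} {x : E d} (hx : x ∈ interior (D.cell T)) :
    D.remainder p v α x = D.elemRemainder T α (D.U p v) x := by
  unfold remainder Mesh.elemRemainder
  refine Finset.sum_congr rfl fun i _ => Finset.sum_congr rfl fun β _ => ?_
  rw [mderiv_congr_of_isOpen isOpen_interior (D.eqOn_N_interior i T) β hx]

theorem intrinsic_eq (p : ℕ) (v : Fin D.nNodes → ℝ) (α : Fin d → ℕ) {T : Fin D.nCells} {x : E d}
    (hx : x ∈ D.cell T) :
    D.intrinsic p v α x = ∑ i, D.localShape T i x * mderiv α (D.U p v i) x := by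
  unfold intrinsic
  simp only [D.N_eq_localShape _ hx]

theorem eqOn_mderiv_uh (p : ℕ) (v : Fin D.nNodes → ℝ) (α : Fin d → ℕ) (T : Fin D.nCells) :
    EqOn (mderiv α (D.uh p v)) (mderiv α fun y => ∑ i, D.localShape T i y * D.U p v i y)
      (interior (D.cell T)) :=
  mderiv_congr_of_isOpen isOpen_interior (fun y hy => by
    simp only [uh, D.eqOn_N_interior _ T hy]) α

theorem mderiv_uh_eq (p : ℕ) (v : Fin D.nNodes → ℝ) (α : Fin d → ℕ) {T : Fin D.nCells} {x : E d}
    (hx : x ∈ interior (D.cell T)) :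
    mderiv α (D.uh p v) x = D.intrinsic p v α x + D.remainder p v α x := by
  have hc := interior_subset hx
  rw [D.eqOn_mderiv_uh p v α T hx, D.mderiv_sum_localShape_mul (fun i => D.U_contDiff p v i)
    (D.cell_subset_smoothDom T _ hc), D.intrinsic_eq p v α hc,
    D.remainder_eq_elemRemainder p v α hx]

theorem sum_mderiv_N {α : Fin d → ℕ} (hα : α ≠ 0) {T : Fin D.nCells} {x : E d}
    (hx : x ∈ interior (D.cell T)) : ∑ i, mderiv α (D.N i) x = 0 := by
  have hc := D.cell_subset_smoothDom T (order α) (interior_subset hx)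
  have h := D.sum_mderiv_localShape_mul hc le_rfl (fun _ => 1)
  simp only [mul_one, D.sum_mderiv_elemShape hc le_rfl hα] at h
  rw [← h]
  exact Finset.sum_congr rfl fun i _ =>
    mderiv_congr_of_isOpen isOpen_interior (D.eqOn_N_interior i T) α hx

/-- Inside an element, `D^α u^h` extends continuously to every point of the closed element. -/
theorem tendsto_mderiv_uh (p : ℕ) (v : Fin D.nNodes → ℝ) (α : Fin d → ℕ) {T : Fin D.nCells}
    {x : E d} (hx : x ∈ D.cell T) :
    Tendsto (mderiv α (D.uh p v)) (𝓝[interior (D.cell T)] x)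
      (𝓝 (D.intrinsic p v α x + D.elemRemainder T α (D.U p v) x)) := by
  have hc := D.cell_subset_smoothDom T (order α) hx
  have ho := D.isOpen_smoothDom T (order α)
  rw [D.intrinsic_eq p v α hx, ← D.mderiv_sum_localShape_mul (fun i => D.U_contDiff p v i) hc]
  have hsm : ContDiffOn ℝ (order α) (fun y => ∑ i, D.localShape T i y * D.U p v i y)
      (D.smoothDom T (order α)) :=
    ContDiffOn.sum fun i _ => (D.localShape_contDiffOn T i _).mul (D.U_contDiff p v i).contDiffOn
  have hcont := (mderivW_contDiffOn ho.fat hsm α (m := 0) (by omega)).continuousOn.congr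
    (mderiv_eqOn_mderivW ho _ α)
  have h1 := (hcont.continuousAt (ho.mem_nhds hc)).tendsto.mono_left
    (nhdsWithin_le_nhds (s := interior (D.cell T)))
  refine h1.congr' ?_
  filter_upwards [self_mem_nhdsWithin] with y hy
  exact (D.eqOn_mderiv_uh p v α T hy).symm

/-- By conformity the intrinsic parts cancel, so the jump is the difference of the one-sided Leibniz
remainders. -/
theorem hasJump_mderiv_uh (p : ℕ) (v : Fin D.nNodes → ℝ) (α : Fin d → ℕ) {T T' : Fin D.nCells}
    {x : E d} (hx : x ∈ D.cell T ∩ D.cell T') :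
    D.HasJump T T' (mderiv α (D.uh p v)) x
      (D.elemRemainder T α (D.U p v) x - D.elemRemainder T' α (D.U p v) x) :=
  ⟨_, _, D.tendsto_mderiv_uh p v α hx.1, D.tendsto_mderiv_uh p v α hx.2, by ring⟩

theorem recon_spec (p : ℕ) (v : Fin D.nNodes → ℝ) (i : Fin D.nNodes) :
    IsCWLS p (D.S i) (D.w i) v (fun k => D.ξ i (D.node k)) (v i) (D.recon p v i) :=
  (exists_isCWLS p (D.S i) (D.w i) v (fun k => D.ξ i (D.node k)) (v i)).choose_spec

theorem ξ_node (i : Fin D.nNodes) : D.ξ i (D.node i) = 0 := by simp [ξ]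

/-! ### Polynomial exactness -/

/-- The polynomial itself has zero residual, so the minimizer has zero residual too, and
well-posedness identifies the two. -/
theorem U_eq_of_polynomial {p : ℕ} (hD : D.WellPosed p) {P : MvPolynomial (Fin d) ℝ}
    (hP : P ∈ Poly d p) {u : E d → ℝ} (hu : ∀ x ∈ closure Ω, u x = peval P x) (i : Fin D.nNodes) :
    D.U p (D.nodal u) i = fun x => peval P x := by
  obtain ⟨r, hr, hrP⟩ := exists_peval_scaled hP (D.node i) (D.ρ_pos i).ne'
  obtain ⟨hq, hq0, hmin⟩ := D.recon_spec p (D.nodal u) i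
  have hru : ∀ k, peval r (D.ξ i (D.node k)) = D.nodal u k := fun k => by
    rw [nodal, hu _ (D.node_mem_closure k)]
    exact hrP _
  have hr0 : peval r (0 : E d) = D.nodal u i := by rw [← hru i, ξ_node]
  have hle := hmin r hr hr0
  have hz : lsq (D.S i) (D.w i) (D.nodal u) (fun k => D.ξ i (D.node k)) r = 0 := by
    simp [lsq, hru]
  rw [hz, lsq] at hle
  have hsum : ∑ k ∈ D.S i, (D.w i k * (peval (D.recon p (D.nodal u) i) (D.ξ i (D.node k)) -
      D.nodal u k)) ^ 2 = 0 :=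
    le_antisymm (by linarith) (Finset.sum_nonneg fun _ _ => sq_nonneg _)
  have heq : D.recon p (D.nodal u) i - r = 0 := by
    refine hD i _ (Submodule.sub_mem _ hq hr) (by rw [peval_sub, hq0, hr0, sub_self])
      fun k hk => ?_
    rw [peval_sub, hru k]
    exact pow_eq_zero_iff (two_ne_zero) |>.1
      ((Finset.sum_eq_zero_iff_of_nonneg fun _ _ => sq_nonneg _).1 hsum k hk)
  ext x
  rw [← hrP x, ← sub_eq_zero.1 heq]
  rfl

theorem elemRemainder_eq_zero_of_polynomial {p : ℕ} (hD : D.WellPosed p)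
    {P : MvPolynomial (Fin d) ℝ} (hP : P ∈ Poly d p) {u : E d → ℝ}
    (hu : ∀ x ∈ closure Ω, u x = peval P x) (α : Fin d → ℕ) {T : Fin D.nCells} {x : E d}
    (hx : x ∈ D.cell T) : D.elemRemainder T α (D.U p (D.nodal u)) x = 0 := by
  rw [D.elemRemainder_eq (D.cell_subset_smoothDom T _ hx)
    fun γ => mderiv γ (fun x => peval P x) x]
  simp [D.U_eq_of_polynomial hD hP hu]

theorem intrinsic_eq_of_polynomial (hΩ : IsOpen Ω) {p : ℕ} (hD : D.WellPosed p)
    {P : MvPolynomial (Fin d) ℝ} (hP : P ∈ Poly d p) {u : E d → ℝ}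
    (hu : ∀ x ∈ closure Ω, u x = peval P x) (α : Fin d → ℕ) {x : E d} (hx : x ∈ Ω) :
    D.intrinsic p (D.nodal u) α x = mderiv α (D.uh p (D.nodal u)) x := by
  have h : EqOn (D.uh p (D.nodal u)) (fun x => peval P x) Ω := fun y hy => by
    simp only [uh, D.U_eq_of_polynomial hD hP hu]
    rw [← Finset.sum_mul, D.sum_N (subset_closure hy), one_mul]
  rw [mderiv_congr_of_isOpen hΩ h α hx]
  simp only [intrinsic, D.U_eq_of_polynomial hD hP hu]
  rw [← Finset.sum_mul, D.sum_N (subset_closure hx), one_mul]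

end Disc

/-! ### Taylor estimates on layers of elements -/

namespace Mesh

variable {d : ℕ} {Ω : Set (E d)} {κ : Type*} {R : κ → RefElement d} (M : Mesh Ω R)

theorem diam_cell_le (T : Fin M.nCells) : Metric.diam (M.cell T) ≤ M.h :=
  le_ciSup (f := fun T => Metric.diam (M.cell T)) (Set.finite_range _).bddAbove T

theorem dist_le_h {T : Fin M.nCells} {x y : E d} (hx : x ∈ M.cell T) (hy : y ∈ M.cell T) :
    ‖x - y‖ ≤ M.h := by
  rw [← dist_eq_norm]
  exact (Metric.dist_le_diam_of_mem (M.isCompact_cell T).isBounded hx hy).trans (M.diam_cell_le T)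

theorem h_pos (hd : 0 < d) (T : Fin M.nCells) : 0 < M.h := by
  have : Nonempty (Fin d) := ⟨⟨0, hd⟩⟩
  obtain ⟨x, hx⟩ := (R (M.kind T)).interior_nonempty
  obtain ⟨y, hy, hyx⟩ : ∃ y ∈ (R (M.kind T)).carrier, y ≠ x := by
    by_contra! h
    have hsub : interior (R (M.kind T)).carrier ⊆ {x} := fun y hy => h y (interior_subset hy)
    have := interior_maximal hsub isOpen_interior hx
    simp [interior_singleton] at this
  have hx' := interior_subset hx
  have hne : M.map T y ≠ M.map T x := fun h => hyx <| by
    rw [← M.coord_map T y hy, ← M.coord_map T x hx', h]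
  exact (norm_pos_iff.2 (sub_ne_zero.2 hne)).trans_le
    (M.dist_le_h (mem_image_of_mem _ hy) (mem_image_of_mem _ hx'))

/-- The oscillation of a function over one element, by the mean value inequality on the convex
reference element. -/
theorem abs_sub_le_of_partialDW_le {f : E d → ℝ}
    (hf : ContDiffOn ℝ 1 f (closure Ω)) {T : Fin M.nCells} {A B Δ : ℝ}
    (hA : ∀ a ∈ (R (M.kind T)).carrier, ‖fderiv ℝ (M.map T) a‖ ≤ A)
    (hΔ : ∀ a ∈ (R (M.kind T)).carrier, ∀ b ∈ (R (M.kind T)).carrier, ‖a - b‖ ≤ Δ)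
    (hB : ∀ j, ∀ x ∈ M.cell T, |partialDW (closure Ω) j f x| ≤ B) {x y : E d}
    (hx : x ∈ M.cell T) (hy : y ∈ M.cell T) : |f x - f y| ≤ d * B * A * Δ := by
  obtain ⟨a, ha, rfl⟩ := hx
  obtain ⟨b, hb, rfl⟩ := hy
  have hmaps : MapsTo (M.map T) (R (M.kind T)).carrier (closure Ω) := fun c hc =>
    M.cell_subset T (mem_image_of_mem _ hc)
  have hder : ∀ c ∈ (R (M.kind T)).carrier, HasFDerivWithinAt (f ∘ M.map T)
      ((fderivWithin ℝ f (closure Ω) (M.map T c)).comp (fderiv ℝ (M.map T) c))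
      (R (M.kind T)).carrier c := fun c hc =>
    ((hf.differentiableOn (by norm_num)) _ (hmaps hc)).hasFDerivWithinAt.comp c
      (((M.map_smooth T c hc).differentiableAt (by simp)).hasFDerivAt.hasFDerivWithinAt) hmaps
  have hbound : ∀ c ∈ (R (M.kind T)).carrier,
      ‖(fderivWithin ℝ f (closure Ω) (M.map T c)).comp (fderiv ℝ (M.map T) c)‖ ≤ d * B * A := by
    intro c hc
    have h1 := norm_fderivWithin_le_of_partialDW fun j => hB j _ (mem_image_of_mem _ hc)
    refine (ContinuousLinearMap.opNorm_comp_le _ _).trans ?_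
    exact mul_le_mul h1 (hA c hc) (norm_nonneg _) ((norm_nonneg _).trans h1)
  have h := (R (M.kind T)).convex.norm_image_sub_le_of_norm_hasFDerivWithin_le hder hbound hb ha
  exact h.trans (mul_le_mul_of_nonneg_left (hΔ a ha b hb)
    ((norm_nonneg _).trans (hbound a ha)))

/-- Taylor's estimate along chains of elements. The domain need not be convex, so a point is
connected to the node through the elements of successive layers; the derivatives of order `p + 1 - k`
are bounded by induction on `k`, integrating over one element at a time. -/
theorem abs_mderivW_le_on_layer (hF : Fat (closure Ω)) {p : ℕ} {f : E d → ℝ}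
    (hf : ContDiffOn ℝ (p + 1 : ℕ) f (closure Ω)) {i : Fin M.nNodes} {B σ Δ : ℝ}
    (hB0 : 0 ≤ B) (hσ : 0 ≤ σ) (hΔ0 : 0 ≤ Δ) (hh : 0 ≤ M.h)
    (hB : ∀ β, order β = p + 1 → ∀ x ∈ closure Ω, |mderivW (closure Ω) β f x| ≤ B)
    (hf0 : ∀ β, order β ≤ p → mderivW (closure Ω) β f (M.node i) = 0)
    (hA : ∀ T, ∀ a ∈ (R (M.kind T)).carrier, ‖fderiv ℝ (M.map T) a‖ ≤ σ * M.h)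
    (hΔ : ∀ T, ∀ a ∈ (R (M.kind T)).carrier, ∀ b ∈ (R (M.kind T)).carrier, ‖a - b‖ ≤ Δ)
    (k s : ℕ) (β : Fin d → ℕ) (hβ : order β + k = p + 1) (T) (hT : T ∈ M.layer i s) (x : E d)
    (hx : x ∈ M.cell T) :
    |mderivW (closure Ω) β f x| ≤ B * (d * σ * Δ * (s + 1)) ^ k * M.h ^ k := by
  induction k generalizing s β T x with
  | zero => simpa using hB β hβ x (M.cell_subset T hx)
  | succ k ihk =>
    have hosc : ∀ s T, T ∈ M.layer i s → ∀ x ∈ M.cell T, ∀ y ∈ M.cell T,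
        |mderivW (closure Ω) β f x - mderivW (closure Ω) β f y| ≤
          d * (B * (d * σ * Δ * (s + 1)) ^ k * M.h ^ k) * (σ * M.h) * Δ := by
      intro s T hT x hx y hy
      refine M.abs_sub_le_of_partialDW_le
        (mderivW_contDiffOn hF hf β (m := 1) (by omega)) (hA T) (hΔ T) (fun j z hz => ?_) hx hy
      rw [partialDW_mderivW hF hf (by omega) j (M.cell_subset T hz)]
      exact ihk s _ (by rw [order_add, order_single]; omega) T hT z hz
    induction s generalizing T x with
    | zero =>
      have h := hosc 0 T hT x hx _ (M.mem_layer_zero.1 hT)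
      rw [hf0 β (by omega), sub_zero] at h
      refine h.trans (le_of_eq ?_)
      push_cast
      ring
    | succ s ihs =>
      obtain ⟨T', hT', z, hz, hz'⟩ := M.mem_layer_succ.1 hT
      have h1 := hosc (s + 1) T hT x hx z hz
      have h2 := ihs T' hT' z hz'
      have h3 := abs_add_le (mderivW (closure Ω) β f x - mderivW (closure Ω) β f z)
        (mderivW (closure Ω) β f z)
      rw [sub_add_cancel] at h3
      refine h3.trans ((add_le_add h1 h2).trans ?_)
      have e : d * (B * (d * σ * Δ * ((s + 1 : ℕ) + 1)) ^ k * M.h ^ k) * (σ * M.h) * Δ +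
          B * (d * σ * Δ * (s + 1)) ^ (k + 1) * M.h ^ (k + 1) =
          B * (d * σ * Δ) ^ (k + 1) * M.h ^ (k + 1) *
            (((s : ℝ) + 2) ^ k + ((s : ℝ) + 1) ^ k * (s + 1)) := by
        push_cast
        simp only [mul_pow]
        ring
      rw [e]
      have e' : B * (d * σ * Δ * ((s + 1 : ℕ) + 1)) ^ (k + 1) * M.h ^ (k + 1) =
          B * (d * σ * Δ) ^ (k + 1) * M.h ^ (k + 1) * (((s : ℝ) + 2) ^ k * (s + 2)) := by
        push_cast
        simp only [mul_pow]
        ring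
      rw [e']
      refine mul_le_mul_of_nonneg_left ?_ (by positivity)
      have hp : ((s : ℝ) + 1) ^ k ≤ ((s : ℝ) + 2) ^ k :=
        pow_le_pow_left₀ (by positivity) (by linarith) k
      nlinarith [mul_le_mul_of_nonneg_right hp (by positivity : (0 : ℝ) ≤ s + 1)]

end Mesh

/-! ### Stability of the constrained least-squares reconstruction -/

/-- The coefficients of the minimizer differ from those of any admissible competitor `r` by a
multiple of the residual of `r`. -/
theorem IsCWLS.abs_coeff_sub_le {d p : ℕ} {ι : Type*} {S : Finset ι} {w v : ι → ℝ} {ξ : ι → E d}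
    {b : ℝ} {q r : MvPolynomial (Fin d) ℝ} (hq : IsCWLS p S w v ξ b q) (hr : r ∈ Poly d p)
    (hrb : peval r 0 = b) {lam W η : ℝ} {m : ℕ} (hlam : 0 < lam) (hη : 0 ≤ η) (hm : S.card ≤ m)
    (hW : ∀ k ∈ S, |w k| ≤ W) (hres : ∀ k ∈ S, |peval r (ξ k) - v k| ≤ η)
    (hmom : ∀ q ∈ Poly d p, lam * ∑ e ∈ q.support, q.coeff e ^ 2 ≤
      ∑ k ∈ S, (w k * peval q (ξ k)) ^ 2) (e : Fin d →₀ ℕ) :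
    |MvPolynomial.coeff e (q - r)| ≤ √(4 * m * W ^ 2 / lam) * η := by
  have hmin := hq.2.2 r hr hrb
  unfold lsq at hmin
  have h1 : ∑ k ∈ S, (w k * (peval r (ξ k) - v k)) ^ 2 ≤ m * (W * η) ^ 2 := by
    calc ∑ k ∈ S, (w k * (peval r (ξ k) - v k)) ^ 2 ≤ ∑ k ∈ S, (W * η) ^ 2 := by
          refine Finset.sum_le_sum fun k hk => ?_
          rw [← sq_abs, abs_mul]
          have := hW k hk
          exact pow_le_pow_left₀ (by positivity)
            (mul_le_mul this (hres k hk) (abs_nonneg _) ((abs_nonneg _).trans this)) 2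
      _ = S.card * (W * η) ^ 2 := by simp
      _ ≤ m * (W * η) ^ 2 := by gcongr
  have h2 : ∑ k ∈ S, (w k * peval (q - r) (ξ k)) ^ 2 ≤
      2 * ∑ k ∈ S, (w k * (peval q (ξ k) - v k)) ^ 2 +
        2 * ∑ k ∈ S, (w k * (peval r (ξ k) - v k)) ^ 2 := by
    rw [Finset.mul_sum, Finset.mul_sum, ← Finset.sum_add_distrib]
    refine Finset.sum_le_sum fun k _ => ?_
    rw [peval_sub]
    nlinarith [sq_nonneg (w k * (peval q (ξ k) - v k) + w k * (peval r (ξ k) - v k))]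
  have h3 := hmom _ (Submodule.sub_mem _ hq.1 hr)
  have h4 : MvPolynomial.coeff e (q - r) ^ 2 ≤
      ∑ e ∈ (q - r).support, MvPolynomial.coeff e (q - r) ^ 2 := by
    by_cases he : e ∈ (q - r).support
    · exact Finset.single_le_sum (f := fun e => MvPolynomial.coeff e (q - r) ^ 2)
        (fun _ _ => sq_nonneg _) he
    · rw [MvPolynomial.notMem_support_iff.1 he]
      simpa using Finset.sum_nonneg fun _ _ => sq_nonneg _
  have h5 : MvPolynomial.coeff e (q - r) ^ 2 ≤ 4 * m * W ^ 2 / lam * η ^ 2 := by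
    rw [div_mul_eq_mul_div, le_div_iff₀ hlam]
    nlinarith [mul_le_mul_of_nonneg_left h4 hlam.le]
  rw [← Real.sqrt_sq hη, ← Real.sqrt_mul (by positivity)]
  exact Real.abs_le_sqrt h5

/-! ### Uniform estimates for regular discretizations -/

section Uniform

variable {d : ℕ} {Ω : Set (E d)} {κ : Type*} {R : κ → RefElement d}

theorem exists_bound_carrier [Finite κ] (R : κ → RefElement d) :
    ∃ Δ : ℝ, 0 ≤ Δ ∧ ∀ k, ∀ a ∈ (R k).carrier, ∀ b ∈ (R k).carrier, ‖a - b‖ ≤ Δ := by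
  obtain ⟨B, hB⟩ := (Set.finite_range fun k => Metric.diam (R k).carrier).bddAbove
  refine ⟨max B 0, le_max_right _ _, fun k a ha b hb => ?_⟩
  rw [← dist_eq_norm]
  exact (Metric.dist_le_diam_of_mem (R k).isCompact.isBounded ha hb).trans
    ((hB (mem_range_self k)).trans (le_max_left _ _))

theorem exists_bound_card [Finite κ] (R : κ → RefElement d) : ∃ n : ℕ, ∀ k, (R k).card ≤ n := by
  obtain ⟨B, hB⟩ := (Set.finite_range fun k => (R k).card).bddAbove
  exact ⟨B, fun k => hB (mem_range_self k)⟩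

theorem exists_bound_iteratedFDeriv_shape [Finite κ] (R : κ → RefElement d) (n : ℕ) :
    ∃ B : ℝ, 0 ≤ B ∧ ∀ k a, ∀ j ≤ n, ∀ x ∈ (R k).carrier,
      ‖iteratedFDeriv ℝ j (fun x => peval ((R k).shape a) x) x‖ ≤ B := by
  have h : ∀ t : (Σ k, Fin (R k).card × Fin (n + 1)), ∃ B : ℝ, ∀ x ∈ (R t.1).carrier,
      ‖iteratedFDeriv ℝ t.2.2 (fun x => peval ((R t.1).shape t.2.1) x) x‖ ≤ B := fun t =>
    (R t.1).isCompact.exists_bound_of_continuousOn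
      ((contDiff_peval _).continuous_iteratedFDeriv (n := t.2.2) le_rfl).continuousOn
  choose c hc using h
  obtain ⟨B, hB⟩ := (Set.finite_range c).bddAbove
  refine ⟨max B 0, le_max_right _ _, fun k a j hj x hx => ?_⟩
  exact (hc ⟨k, a, ⟨j, by omega⟩⟩ x hx).trans ((hB (mem_range_self _)).trans (le_max_left _ _))

/-- Derivatives of the element shape functions scale like negative powers of the mesh size. -/
theorem exists_bound_elemShape [Finite κ] (hd : 0 < d) (R : κ → RefElement d) {p : ℕ}
    {σ lam W : ℝ} {m L : ℕ} :
    ∃ C : ℝ, 0 ≤ C ∧ ∀ D : Disc Ω R, D.Regular p σ lam W m L → ∀ β, order β ≤ p + 1 →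
      ∀ T a, ∀ x ∈ D.cell T, |mderiv β (D.elemShape T a) x| ≤ C / D.h ^ order β := by
  obtain ⟨B, hB0, hB⟩ := exists_bound_iteratedFDeriv_shape R (p + 1)
  set τ := max σ 1
  have hτ : 1 ≤ τ := le_max_right _ _
  refine ⟨(p + 1).factorial * B * τ ^ (p + 1), by positivity, fun D hD β hβ T a x hx => ?_⟩
  have hh := D.h_pos hd T
  have ho := D.isOpen_smoothDom T (p + 1)
  have hxo := D.cell_subset_smoothDom T (p + 1) hx
  rw [mderiv_eqOn_mderivW ho _ β hxo]
  refine (abs_mderivW_le ho.fat (D.elemShape_contDiffOn T a (p + 1)) β hβ hxo).trans ?_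
  obtain ⟨b, hb, rfl⟩ := hx
  have hcomp := norm_iteratedFDerivWithin_comp_le (n := order β) (N := ((p + 1 : ℕ) : WithTop ℕ∞))
    (g := fun x => peval ((R (D.kind T)).shape a) x) (t := univ) (C := B) (D := τ / D.h)
    (contDiff_peval _).contDiffOn (D.coord_contDiffOn T (p + 1)) (by exact_mod_cast hβ)
    uniqueDiffOn_univ ho.uniqueDiffOn (mapsTo_univ _ _) hxo
    (fun j hj => by
      rw [iteratedFDerivWithin_univ, D.coord_map T b hb]
      exact hB _ a j (hj.trans hβ) b hb)
    (fun j h1 hj => by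
      rw [iteratedFDerivWithin_of_isOpen j ho hxo, div_pow]
      refine (hD.coord_le T b hb j h1 (hj.trans hβ)).trans ?_
      gcongr
      exact (le_max_left σ 1).trans (le_self_pow₀ hτ (by omega)))
  refine hcomp.trans ?_
  rw [div_pow, ← mul_div_assoc]
  gcongr

/-- The local approximants and their derivatives approximate a smooth field on the elements at their
node: the reconstruction is compared with the Taylor polynomial at the node. -/
theorem exists_bound_mderiv_U [Finite κ] (hd : 0 < d)
    (hbdd : Bornology.IsBounded Ω) (hF : Fat (closure Ω)) (R : κ → RefElement d) {p : ℕ}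
    {σ lam W : ℝ} {m L : ℕ} (hlam : 0 < lam) {u : E d → ℝ}
    (hu : ContDiffOn ℝ (p + 1 : ℕ) u (closure Ω)) :
    ∃ C : ℝ, 0 ≤ C ∧ ∀ γ : Fin d → ℕ, order γ ≤ p + 1 → ∀ D : Disc Ω R,
      D.Regular p σ lam W m L → ∀ i T, D.node i ∈ D.cell T → ∀ x ∈ D.cell T,
        |mderiv γ (D.U p (D.nodal u) i) x - mderivW (closure Ω) γ u x| ≤
          C * D.h ^ (p + 1 - order γ) := by
  obtain ⟨Δ, hΔ0, hΔ⟩ := exists_bound_carrier R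
  have hcpt : IsCompact (closure Ω) := hbdd.isCompact_closure
  obtain ⟨B, hB0, hB⟩ := exists_uniform_const (n := p + 1)
    (q := fun β C => ∀ x ∈ closure Ω, |mderivW (closure Ω) β u x| ≤ C)
    (fun _ _ _ h h' x hx => (h' x hx).trans h) (fun β hβ => hcpt.exists_bound_of_continuousOn
      (mderivW_contDiffOn hF hu β (m := 0) (by omega)).continuousOn)
  -- a positive bound for `σ`, whose sign is not prescribed
  set K : ℝ := |σ| + 1
  have hK : 0 < K := by positivity
  refine exists_uniform_const (fun γ C C' hC h D hD i T hi x hx =>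
    (h D hD i T hi x hx).trans (mul_le_mul_of_nonneg_right hC
      (pow_nonneg (D.h_pos hd T).le _))) fun γ hγ => ?_
  obtain ⟨Cγ, hCγ0, hCγ⟩ := exists_bound_mpderiv (d := d) p γ K
  set c₁ : ℝ := B * (d * K * Δ * (L + 1)) ^ (p + 1)
  set c₀ : ℝ := B * (d * K * Δ * (0 + 1)) ^ (p + 1 - order γ)
  have hc₁ : 0 ≤ c₁ := by positivity
  refine ⟨K ^ order γ * (Cγ * (√(4 * m * W ^ 2 / lam) * c₁)) + c₀,
    fun D hD i T hi x hx => ?_⟩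
  have hh := D.h_pos hd T
  have hρ := D.ρ_pos i
  have hhK : D.h ≤ K * D.ρ i := (hD.h_le i).trans
    (mul_le_mul_of_nonneg_right ((le_abs_self σ).trans (by simp [K])) hρ.le)
  obtain ⟨r, hr, hrV⟩ := exists_poly_with_derivs (d := d) p
    fun β => D.ρ i ^ order β * mderivW (closure Ω) β u (D.node i)
  set g : E d → ℝ := fun x => peval r (D.ξ i x)
  have hg : ∀ n : ℕ, ContDiff ℝ n g := fun n =>
    (contDiff_peval _).comp ((contDiff_id.sub contDiff_const).const_smul _)
  have hgder : ∀ β x, mderiv β g x = (D.ρ i)⁻¹ ^ order β * peval (mpderiv β r) (D.ξ i x) :=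
    fun β x => mderiv_peval_comp_affine r _ _ β x
  have hsub : ∀ β, order β ≤ p + 1 → ∀ y ∈ closure Ω,
      mderivW (closure Ω) β (fun y => u y - g y) y =
        mderivW (closure Ω) β u y - mderiv β g y := fun β hβ y hy => by
    rw [mderivW_sub hF hu (hg (p + 1)).contDiffOn hβ hy]
    beta_reduce
    rw [mderivW_eq_mderiv hF (hg _) hy]
  -- by the choice of `r`, `g` is the Taylor polynomial of `u` at the node
  have hf0 : ∀ β, order β ≤ p →
      mderivW (closure Ω) β (fun y => u y - g y) (D.node i) = 0 := fun β hβ => by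
    rw [hsub β (by omega) _ (D.node_mem_closure i), hgder, D.ξ_node, hrV β hβ, inv_pow,
      inv_mul_cancel_left₀ (pow_ne_zero _ hρ.ne'), sub_self]
  have hfB : ∀ β, order β = p + 1 → ∀ y ∈ closure Ω,
      |mderivW (closure Ω) β (fun y => u y - g y) y| ≤ B := fun β hβ y hy => by
    rw [hsub β hβ.le y hy, hgder, mpderiv_eq_zero hr (by omega)]
    simpa [peval] using hB β hβ.le y hy
  have htaylor := D.abs_mderivW_le_on_layer hF (hu.sub (hg (p + 1)).contDiffOn) hB0 hK.le hΔ0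
    hh.le hfB hf0 (fun T a ha => (hD.map_le T a ha).trans
      (mul_le_mul_of_nonneg_right ((le_abs_self σ).trans (by simp [K])) hh.le))
    (fun T => hΔ (D.kind T))
  have hgi : peval r (0 : E d) = D.nodal u i := by
    have h := hf0 0 (by simp [order])
    rw [mderivW_zero] at h
    have h' : g (D.node i) = peval r 0 := by simp only [g, D.ξ_node]
    rw [← h', Disc.nodal]
    linarith
  have hres : ∀ k ∈ D.S i, |peval r (D.ξ i (D.node k)) - D.nodal u k| ≤ c₁ * D.h ^ (p + 1) := by
    intro k hk
    obtain ⟨T', hT', hk'⟩ : ∃ T' ∈ D.patch i, D.node k ∈ D.cell T' := by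
      classical
      simpa [Disc.patchRegion] using (Finset.mem_filter.1 hk).2
    have h := htaylor (p + 1) L 0 (by simp [order]) T' (hD.patch_subset i hT') _ hk'
    rw [mderivW_zero, abs_sub_comm] at h
    exact h
  have hcoeff := (D.recon_spec p (D.nodal u) i).abs_coeff_sub_le hr hgi hlam
    (by positivity) (hD.card_le i) (hD.weight_le i) hres (hD.moment_ge i)
  have hξ : ‖D.ξ i x‖ ≤ K := by
    rw [Disc.ξ, norm_smul, norm_inv, Real.norm_of_nonneg hρ.le, inv_mul_le_iff₀ hρ, mul_comm]
    exact (D.dist_le_h hx hi).trans hhK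
  have hpoly := hCγ _ (Submodule.sub_mem _ (D.recon_spec p (D.nodal u) i).1 hr) _ hcoeff _ hξ
  have h1 : |mderiv γ (D.U p (D.nodal u) i) x - mderiv γ g x| ≤
      K ^ order γ * (Cγ * (√(4 * m * W ^ 2 / lam) * c₁)) * D.h ^ (p + 1 - order γ) := by
    rw [D.mderiv_U, hgder, ← mul_sub, ← peval_sub, ← map_sub, abs_mul, abs_of_nonneg
      (by positivity)]
    have hinv : (D.ρ i)⁻¹ ≤ K / D.h := by
      rw [inv_le_comm₀ hρ (by positivity), inv_div, div_le_iff₀ hK, mul_comm]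
      exact hhK
    have hsplit : D.h ^ (p + 1) = D.h ^ order γ * D.h ^ (p + 1 - order γ) := by
      rw [← pow_add]; congr 1; omega
    calc (D.ρ i)⁻¹ ^ order γ * |peval (mpderiv γ (D.recon p (D.nodal u) i - r)) (D.ξ i x)|
        ≤ (K / D.h) ^ order γ * (Cγ * (√(4 * m * W ^ 2 / lam) * (c₁ * D.h ^ (p + 1)))) := by
          gcongr
      _ = _ := by
          rw [hsplit, div_pow]
          field_simp
  have h2 : |mderiv γ g x - mderivW (closure Ω) γ u x| ≤ c₀ * D.h ^ (p + 1 - order γ) := by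
    have h := htaylor (p + 1 - order γ) 0 γ (by omega) T (D.mem_layer_zero.2 hi) x hx
    rw [hsub γ hγ x (D.cell_subset T hx), abs_sub_comm] at h
    simpa [c₀] using h
  rw [add_mul]
  exact (abs_sub_le _ _ _).trans (add_le_add h1 h2)

/-- The building blocks of both the intrinsic derivative (`β = 0`) and the Leibniz remainder
(`β ≠ 0`): the loss `h ^ (-|β|)` from the shape functions is compensated by the local
approximation. -/
theorem exists_bound_sum_elemShape [Finite κ] (hd : 0 < d)
    (hbdd : Bornology.IsBounded Ω) (hF : Fat (closure Ω)) (R : κ → RefElement d) {p : ℕ}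
    {σ lam W : ℝ} {m L : ℕ} (hlam : 0 < lam) {u : E d → ℝ}
    (hu : ContDiffOn ℝ (p + 1 : ℕ) u (closure Ω)) :
    ∃ C : ℝ, 0 ≤ C ∧ ∀ D : Disc Ω R, D.Regular p σ lam W m L → ∀ α : Fin d → ℕ,
      order α ≤ p + 1 → ∀ β ≤ α, ∀ T, ∀ x ∈ D.cell T,
        |∑ a, mderiv β (D.elemShape T a) x *
            (mderiv (α - β) (D.U p (D.nodal u) (D.conn T a)) x -
              mderivW (closure Ω) (α - β) u x)| ≤ C * D.h ^ (p + 1 - order α) := by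
  obtain ⟨n, hn⟩ := exists_bound_card R
  obtain ⟨C₁, hC₁, h₁⟩ := exists_bound_elemShape (Ω := Ω) hd R (p := p) (σ := σ) (lam := lam)
    (W := W) (m := m) (L := L)
  obtain ⟨C₂, hC₂, h₂⟩ := exists_bound_mderiv_U hd hbdd hF R (σ := σ) (W := W) (m := m)
    (L := L) hlam hu
  refine ⟨n * (C₁ * C₂), by positivity, fun D hD α hα β hβ T x hx => ?_⟩
  have hh := D.h_pos hd T
  have hsub := order_sub hβ
  calc _ ≤ ∑ a : Fin (R (D.kind T)).card,
          C₁ / D.h ^ order β * (C₂ * D.h ^ (p + 1 - order (α - β))) := by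
        refine (Finset.abs_sum_le_sum_abs _ _).trans (Finset.sum_le_sum fun a _ => ?_)
        rw [abs_mul]
        exact mul_le_mul (h₁ D hD β (by omega) T a x hx)
          (h₂ _ (by omega) D hD _ T (D.node_conn_mem_cell T a) x hx) (abs_nonneg _) (by positivity)
    _ = (R (D.kind T)).card * (C₁ * C₂) * D.h ^ (p + 1 - order α) := by
        have : p + 1 - order (α - β) = order β + (p + 1 - order α) := by omega
        rw [this, pow_add]
        simp
        field_simp
    _ ≤ _ := by
        gcongr
        exact hn _

theorem exists_bound_elemRemainder [Finite κ] (hd : 0 < d)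
    (hbdd : Bornology.IsBounded Ω) (hF : Fat (closure Ω)) (R : κ → RefElement d) {p : ℕ}
    {σ lam W : ℝ} {m L : ℕ} (hlam : 0 < lam) {u : E d → ℝ}
    (hu : ContDiffOn ℝ (p + 1 : ℕ) u (closure Ω)) :
    ∃ C : ℝ, 0 ≤ C ∧ ∀ α : Fin d → ℕ, order α ≤ p + 1 → ∀ D : Disc Ω R,
      D.Regular p σ lam W m L → ∀ T, ∀ x ∈ D.cell T,
        |D.elemRemainder T α (D.U p (D.nodal u)) x| ≤ C * D.h ^ (p + 1 - order α) := by
  obtain ⟨C, hC, h⟩ := exists_bound_sum_elemShape hd hbdd hF R (σ := σ) (W := W) (m := m)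
    (L := L) hlam hu
  refine exists_uniform_const (fun γ C C' hC h D hD T x hx =>
    (h D hD T x hx).trans (mul_le_mul_of_nonneg_right hC
      (pow_nonneg (D.h_pos hd T).le _))) fun α hα => ?_
  refine ⟨(∑ β ∈ Finset.Ioc 0 α, (mchoose α β : ℝ)) * C, fun D hD T x hx => ?_⟩
  rw [D.elemRemainder_eq (D.cell_subset_smoothDom T _ hx)
    fun γ => mderivW (closure Ω) γ u x, Finset.sum_mul, Finset.sum_mul]
  refine (Finset.abs_sum_le_sum_abs _ _).trans (Finset.sum_le_sum fun β hβ => ?_)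
  rw [abs_mul, Nat.abs_cast, mul_assoc]
  exact mul_le_mul_of_nonneg_left (h D hD α hα β (Finset.mem_Ioc.1 hβ).2 T x hx)
    (Nat.cast_nonneg _)

theorem exists_bound_intrinsic [Finite κ] (hd : 0 < d) (hΩ : IsOpen Ω)
    (hbdd : Bornology.IsBounded Ω) (hF : Fat (closure Ω)) (R : κ → RefElement d) {p : ℕ}
    {σ lam W : ℝ} {m L : ℕ} (hlam : 0 < lam) {u : E d → ℝ}
    (hu : ContDiffOn ℝ (p + 1 : ℕ) u (closure Ω)) :
    ∃ C : ℝ, 0 ≤ C ∧ ∀ D : Disc Ω R, D.Regular p σ lam W m L → ∀ α : Fin d → ℕ,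
      order α ≤ p + 1 → ∀ x ∈ Ω,
        |mderiv α u x - D.intrinsic p (D.nodal u) α x| ≤ C * D.h ^ (p + 1 - order α) := by
  obtain ⟨C, hC, h⟩ := exists_bound_sum_elemShape hd hbdd hF R (σ := σ) (W := W) (m := m)
    (L := L) hlam hu
  refine ⟨C, hC, fun D hD α hα x hx => ?_⟩
  obtain ⟨T, hT⟩ := D.exists_mem_cell (subset_closure hx)
  have h0 := h D hD α hα 0 (fun _ => Nat.zero_le _) T x hT
  have hz : ∀ f : E d → ℝ, mderiv 0 f = f := fun f => by
    rw [mderiv_eq_mderivW_univ, mderivW_zero]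
  have hsum := D.sum_mderiv_localShape_mul (D.cell_subset_smoothDom T 0 hT) (β := 0)
    (by simp [order]) (fun i => mderiv α (D.U p (D.nodal u) i) x)
  simp only [hz, tsub_zero, mul_sub, Finset.sum_sub_distrib] at h0 hsum
  rw [← Finset.sum_mul, D.sum_elemShape, one_mul, ← hsum, ← D.intrinsic_eq p _ α hT,
    mderivW_of_isOpen_subset hΩ subset_closure u α hx, ← mderiv_eqOn_mderivW hΩ u α hx,
    abs_sub_comm] at h0
  exact h0

end Uniform

end MiGFEM

theorem mainTheorem3 {d : ℕ} (hd : 0 < d) (p : ℕ) (Ω : Set (MiGFEM.E d)) (hΩ : IsOpen Ω)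
    (hconn : IsConnected Ω) (hbdd : Bornology.IsBounded Ω)
    {κ : Type*} [Finite κ] (R : κ → MiGFEM.RefElement d) :
    -- decomposition of the Leibniz derivative, partition-of-zero identity, and continuity of the
    -- intrinsic derivative, for arbitrary nodal data
    (∀ (D : MiGFEM.Disc Ω R) (v : Fin D.nNodes → ℝ) (α : Fin d → ℕ),
      (∀ T, ∀ x ∈ interior (D.cell T),
        MiGFEM.mderiv α (D.uh p v) x = D.intrinsic p v α x + D.remainder p v α x ∧
        (0 < α → ∑ i, MiGFEM.mderiv α (D.N i) x = 0)) ∧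
      ContinuousOn (D.intrinsic p v α) (closure Ω)) ∧
    -- polynomial exactness
    (∀ D : MiGFEM.Disc Ω R, D.WellPosed p → ∀ P ∈ MiGFEM.Poly d p, ∀ u : MiGFEM.E d → ℝ,
      (∀ x ∈ closure Ω, u x = MiGFEM.peval P x) → ∀ α : Fin d → ℕ, MiGFEM.order α ≤ p →
      (∀ x ∈ Ω, D.intrinsic p (D.nodal u) α x = MiGFEM.mderiv α (D.uh p (D.nodal u)) x) ∧
      (∀ T, ∀ x ∈ interior (D.cell T), D.remainder p (D.nodal u) α x = 0) ∧
      (∀ T T', T ≠ T' → ∀ x ∈ D.cell T ∩ D.cell T',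
        D.HasJump T T' (MiGFEM.mderiv α (D.uh p (D.nodal u))) x 0)) ∧
    -- approximation order for smooth fields
    (∀ (σ lam W : ℝ) (m L : ℕ), 0 < lam → ∀ u : MiGFEM.E d → ℝ,
      ContDiffOn ℝ (p + 1) u (closure Ω) →
      ∃ C : ℝ, ∀ D : MiGFEM.Disc Ω R, D.Regular p σ lam W m L →
        ∀ α : Fin d → ℕ, MiGFEM.order α ≤ p + 1 →
        MeasureTheory.eLpNorm
            (fun x => MiGFEM.mderiv α u x - D.intrinsic p (D.nodal u) α x) ⊤
            (MeasureTheory.volume.restrict Ω) ≤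
          ENNReal.ofReal (C * D.h ^ (p + 1 - MiGFEM.order α)) ∧
        (∀ T, ∀ x ∈ interior (D.cell T),
          |D.remainder p (D.nodal u) α x| ≤ C * D.h ^ (p + 1 - MiGFEM.order α)) ∧
        (∀ T T', T ≠ T' → ∀ x ∈ D.cell T ∩ D.cell T', ∃ J,
          D.HasJump T T' (MiGFEM.mderiv α (D.uh p (D.nodal u))) x J ∧
          |J| ≤ C * D.h ^ (p + 1 - MiGFEM.order α))) := by
  refine ⟨fun D v α => ⟨fun T x hx => ⟨D.mderiv_uh_eq p v α hx,
    fun hα => D.sum_mderiv_N hα.ne' hx⟩, D.continuousOn_intrinsic p v α⟩, ?_, ?_⟩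
  · intro D hD P hP u hu α _
    refine ⟨fun x hx => D.intrinsic_eq_of_polynomial hΩ hD hP hu α hx, fun T x hx => ?_,
      fun T T' _ x hx => ?_⟩
    · rw [D.remainder_eq_elemRemainder p _ α hx]
      exact D.elemRemainder_eq_zero_of_polynomial hD hP hu α (interior_subset hx)
    · have h := D.hasJump_mderiv_uh p (D.nodal u) α hx
      rwa [D.elemRemainder_eq_zero_of_polynomial hD hP hu α hx.1,
        D.elemRemainder_eq_zero_of_polynomial hD hP hu α hx.2, sub_zero] at h
  · intro σ lam W m L hlam u hu
    -- the regularity of `closure Ω` needed to differentiate up to the boundary comes from a mesh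
    by_cases hne : Nonempty (MiGFEM.Disc Ω R)
    swap
    · exact ⟨0, fun D => (hne ⟨D⟩).elim⟩
    have hF : MiGFEM.Fat (closure Ω) := hne.some.fat_closure hΩ
    have hu' : ContDiffOn ℝ (p + 1 : ℕ) u (closure Ω) := by exact_mod_cast hu
    obtain ⟨C₁, hC₁, h₁⟩ := MiGFEM.exists_bound_intrinsic hd hΩ hbdd hF R (σ := σ) (W := W)
      (m := m) (L := L) hlam hu'
    obtain ⟨C₂, hC₂, h₂⟩ := MiGFEM.exists_bound_elemRemainder hd hbdd hF R (σ := σ) (W := W)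
      (m := m) (L := L) hlam hu'
    refine ⟨C₁ + 2 * C₂, fun D hD α hα => ?_⟩
    obtain ⟨x₀, hx₀⟩ := hconn.nonempty
    obtain ⟨T₀, -⟩ := D.exists_mem_cell (subset_closure hx₀)
    have hpow : 0 ≤ D.h ^ (p + 1 - MiGFEM.order α) := pow_nonneg (D.h_pos hd T₀).le _
    have hmul₁ := mul_nonneg hC₁ hpow
    have hmul₂ := mul_nonneg hC₂ hpow
    refine ⟨?_, fun T x hx => ?_, fun T T' _ x hx => ⟨_, D.hasJump_mderiv_uh p _ α hx, ?_⟩⟩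
    · rw [MeasureTheory.eLpNorm_exponent_top]
      refine MeasureTheory.eLpNormEssSup_le_of_ae_bound ?_
      filter_upwards [MeasureTheory.ae_restrict_mem hΩ.measurableSet] with x hx
      rw [Real.norm_eq_abs]
      linarith [h₁ D hD α hα x hx]
    · rw [D.remainder_eq_elemRemainder p _ α hx]
      linarith [h₂ α hα D hD T x (interior_subset hx)]
    · linarith [abs_sub (D.elemRemainder T α (D.U p (D.nodal u)) x)
        (D.elemRemainder T' α (D.U p (D.nodal u)) x), h₂ α hα D hD T x hx.1, h₂ α hα D hD T' x hx.2]
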